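/- **Setting.** Let $\mathcal S(\mathbb C^3)$ be the set of positive semi-definite operators on $\mathbb C^3$ of unit trace; for $w\neq 0$ let $\rho_w$ be the orthogonal projection on $\operatorname{span}\{w\}$. Let $U$ be a unitary operator on $\mathbb C^3$ and $\Pi=\{\Pi_1,\Pi_2\}$ orthogonal projections with $\Pi_1+\Pi_2=\mathbb I$, $\operatorname{rank}\Pi_1=2$, $\operatorname{rank}\Pi_2=1$. Let $\mathsf z$ be a unit vector spanning $\operatorname{im}\Pi_2$, and put $\Theta=\operatorname{im}\Pi_1=\{\mathsf z\}^\perp$, $\rho_{\mathsf m}=\frac12\Pi_1$, $\mathsf v=\Pi_1U\mathsf z$, $\omega=\langle\mathsf z|U\mathsf z\rangle$. For $i=1,2$ let $$\mathsf p_i(\rho)=\operatorname{tr}(\Pi_iU\rho U^*),\qquad \mathsf F_i(\rho)=\frac{\Pi_iU\rho U^*\Pi_i}{\operatorname{tr}(\Pi_iU\rho U^*)}\ \text{ if } \mathsf p_i(\rho)>0 .$$ The Markov chain generated by this partial iterated function system is obtained by starting in $\rho_*=\frac13\mathbb I$ and repeatedly replacing $\rho$ by $\mathsf F_i(\rho)$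 with probability $\mathsf p_i(\rho)$. Its state space $\mathsf S_*$ consists of all states reached with positive probability after at least one step, its initial distribution is the law after the first step, and its transition probabilities are $\mathsf P_*(\rho,\varrho)=\sum_{i:\,\mathsf F_i(\rho)=\varrho}\mathsf p_i(\rho)$. Let $\lambda_1,\lambda_2$ with $|\lambda_2|\le|\lambda_1|$ be the eigenvalues, counted with algebraic multiplicity, of $A=\Pi_1U|_\Theta\colon\Theta\to\Theta$, and let $e_1,e_2\in\Theta$ be eigenvectors of $A$ for $\lambda_1,\lambda_2$. If $\lambda_1,\lambda_2\ne0$, put $\psi=\operatorname{Arg}(\lambda_2/\lambda_1)\in(-\pi,\pi]$. A state $\rho$ with $\operatorname{im}\rho\subset\Theta$ is called *pure* if $\rho=\rho_w$ for some $w$ and *mixed* otherwise. Trajectories are taken under $\mathsf F_1$; *infinite* means defined at all times with pairwise distinct terms. A trajectory $(s_n)$ is *almost periodic* if for every $m$ and every neighbourhood $V$ of $s_m$ the set $\{n: s_n\in V\}$ has bounded gaps in $\mathbb N$; it is *periodic with period $\kappa$* if $s_m=s_n\iff m\equiv n \pmod\kappa$. **Theorem.** The initial distribution is $\frac23\delta_{\rho_{\mathsf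 m}}+\frac13\delta_{\rho_{\mathsf z}}$, and $\mathsf S_*$ consists of the (possibly terminating) trajectories of $\rho_{\mathsf z}$ and $\rho_{\mathsf m}$ under $\mathsf F_1$. From any state $\rho$ the system goes to $\rho_{\mathsf z}$ with probability $\mathsf p_2(\rho)$, to $\mathsf F_1(\rho)$ (if defined) with probability $\mathsf p_1(\rho)$, and to no other state. Exactly one of the following eight conditions on $(\lambda_1,\lambda_2)$ holds (generic, taupek, $\infty$-elliptic, finite-elliptic, generic-null, taupek-null, double-null, unitary). In all cases but the unitary one, $\mathsf v\ne0$, $\rho_{\mathsf v}=\mathsf F_1(\rho_{\mathsf z})$ is a pure state with image in $\Theta$, and $\mathsf p_1(\rho_{\mathsf z})=1-|\omega|^2$. Moreover: - **generic**: if $0<|\lambda_2|<|\lambda_1|<1$, or $\lambda_1=\lambda_2$ with $0<|\lambda_1|<1$, then $\rho_{\mathsf v}$ has an infinite trajectory over pure states and $\rho_{\mathsf m}$ has an infinite trajectory over mixed states; both converge to $\rho_{e_1}$. - **taupek**: if $0<|\lambda_2|<|\lambda_1|=1$, then $\rho_{\mathsf v}=\rho_{e_2}$, $\mathsf F_1(\rho_{\mathsf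 v})=\rho_{\mathsf v}$ and the system loops there with probability $|\lambda_2|^2$, while $\rho_{\mathsf m}$ has an infinite trajectory over mixed states, convergent to $\rho_{e_1}$. - **$\infty$-elliptic**: if $0<|\lambda_2|=|\lambda_1|<1$ and $\psi\notin\pi\mathbb Q$, then $\rho_{\mathsf v}$ has an infinite trajectory over pure states and $\rho_{\mathsf m}$ has an infinite trajectory over mixed states; both are almost periodic. - **finite-elliptic**: if $0<|\lambda_2|=|\lambda_1|<1$ and $\psi\in\pi\mathbb Q\setminus\{0\}$, then $\rho_{\mathsf v}$ has a periodic trajectory over pure states and $\rho_{\mathsf m}$ has a periodic trajectory over mixed states; both have period $\kappa\ge2$, where $e^{\mathrm i\psi}$ is a primitive $\kappa$-th root of unity. The chain is called *circular* if $\kappa=2$, i.e. if $\psi=\pi$. - **null**: if $\lambda_2=0$, then $\mathsf p_1(\rho_{\mathsf z})=1-|\omega|^2=1$ and the system cannot loop over $\rho_{\mathsf z}$. There are three subtypes: - **generic-null**: if moreover $0<|\lambda_1|<1$, then $\mathsf F_1(\rho_{\mathsf m})=\mathsf F_1(\rho_{\mathsf v})=\rho_{e_1}=\mathsf F_1(\rho_{e_1})$,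 and the system loops over $\rho_{e_1}$ with probability $|\lambda_1|^2$; - **taupek-null**: if moreover $|\lambda_1|=1$, then $\mathsf F_1(\rho_{\mathsf m})=\rho_{e_1}=\mathsf F_1(\rho_{e_1})$ and the system loops over $\rho_{e_1}$ with probability $1$, while $\rho_{\mathsf v}=\rho_{e_2}$, $\mathsf p_1(\rho_{\mathsf v})=0$ and the system returns from $\rho_{\mathsf v}$ to $\rho_{\mathsf z}$ with probability $1$; - **double-null**: if moreover $\lambda_1=0$, then $\mathsf F_1(\rho_{\mathsf m})=\mathsf F_1(\rho_{\mathsf v})=\rho_{e_1}$, $\mathsf p_1(\rho_{e_1})=0$ and the system goes from $\rho_{e_1}$ to $\rho_{\mathsf z}$ with probability $1$. - **unitary**: if $|\lambda_2|=|\lambda_1|=1$, then $\rho_{\mathsf z}$ and $\rho_{\mathsf m}$ have trivial trajectories: $\mathsf p_2(\rho_{\mathsf z})=1$, $\mathsf F_2(\rho_{\mathsf z})=\rho_{\mathsf z}$, $\mathsf p_1(\rho_{\mathsf z})=0$, $\mathsf p_1(\rho_{\mathsf m})=1$, $\mathsf F_1(\rho_{\mathsf m})=\rho_{\mathsf m}$;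 hence $\mathsf S_*=\{\rho_{\mathsf z},\rho_{\mathsf m}\}$ with $\rho_{\mathsf z}\neq\rho_{\mathsf m}$, and $\mathsf P_*$ is the identity matrix. -/

import Mathlib

open Filter Topology Polynomial
open scoped Matrix ComplexOrder

noncomputable section

namespace QPIFS

/-! ### Partial iterated function systems and the Markov chains they generate -/

/-- A partial iterated function system on `X` with `k` outcomes: place-dependent probabilities
`p i : X → [0, 1]` adding up to `1`, and evolution maps `F i` defined where `p i` is positive. -/
structure PIFS (k : ℕ) (X : Type*) where
  p : Fin k → X → ℝ
  p_nonneg : ∀ i x, 0 ≤ p i x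
  p_le_one : ∀ i x, p i x ≤ 1
  sum_p : ∀ x, ∑ i, p i x = 1
  F : (i : Fin k) → {x : X // 0 < p i x} → X

namespace PIFS

variable {k : ℕ} {X : Type*} (P : PIFS k X)

/-- `x` lies in the domain of `F i` and `F i x = y`. -/
def Maps (i : Fin k) (x y : X) : Prop :=
  ∃ h : 0 < P.p i x, P.F i ⟨x, h⟩ = y

/-- `P.Evolves ι x y`: the string `ι` (its first symbol acts first) has positive probability
at `x`, and the corresponding composition of evolution maps sends `x` to `y`. -/
def Evolves : List (Fin k) → X → X → Prop
  | [], x, y => x = y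
  | i :: ι, x, y => ∃ x', P.Maps i x x' ∧ Evolves ι x' y

/-- The state space of the chain started at `x₀`: all states reached by non-empty strings of
positive probability. -/
def stateSpace (x₀ : X) : Set X :=
  {y | ∃ ι : List (Fin k), ι ≠ [] ∧ P.Evolves ι x₀ y}

open Classical in
/-- The transition probability `∑_{i : F i x = y} p i x`. -/
def trans (x y : X) : ℝ :=
  ∑ i, if P.Maps i x y then P.p i x else 0

/-- The initial distribution of the chain, i.e. the law of the state after the first step
of the system prepared in `x₀`. -/
def initDist (x₀ : X) : X → ℝ := fun y => P.trans x₀ y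

/-- `s` is the infinite forward trajectory of `x` under the (partial) map `F i`; in particular
every `s n` lies in the domain of `F i`. -/
def IsTrajectory (i : Fin k) (x : X) (s : ℕ → X) : Prop :=
  s 0 = x ∧ ∀ n, P.Maps i (s n) (s (n + 1))

end PIFS

/-- Almost periodicity of a trajectory: every one of its points returns to each of its
neighbourhoods along a syndetic set of times (a set of times with bounded gaps). -/
def AlmostPeriodic {X : Type*} [TopologicalSpace X] (s : ℕ → X) : Prop :=
  ∀ m, ∀ V ∈ 𝓝 (s m), ∃ L : ℕ, ∀ n, ∃ j ≤ L, s (n + j) ∈ V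

/-- The trajectory is periodic and its (least) period is `κ`. -/
def PeriodicWithPeriod {X : Type*} (s : ℕ → X) (κ : ℕ) : Prop :=
  0 < κ ∧ ∀ m n, s m = s n ↔ m ≡ n [MOD κ]

/-! ### Quantum states -/

/-- The Hilbert space `ℂ^d`. -/
abbrev Hilb (d : ℕ) := EuclideanSpace ℂ (Fin d)

/-- The quantum states on `ℂ^d`: positive semi-definite matrices of unit trace, with the
topology of the space of matrices. -/
abbrev State (d : ℕ) := {ρ : Matrix (Fin d) (Fin d) ℂ // ρ.PosSemidef ∧ ρ.trace = 1}

variable {d k : ℕ}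

/-- The state `M / tr M`, for a positive semi-definite matrix `M` of non-zero trace. -/
def normState (M : Matrix (Fin d) (Fin d) ℂ) (hM : M.PosSemidef) (h : M.trace ≠ 0) : State d :=
  ⟨M.trace⁻¹ • M, hM.smul (inv_nonneg.2 hM.trace_nonneg), by
    rw [Matrix.trace_smul, smul_eq_mul, inv_mul_cancel₀ h]⟩

/-- The maximally mixed state `𝕀 / d`. -/
def maxMixed (d : ℕ) [NeZero d] : State d :=
  normState 1 Matrix.PosSemidef.one (by simp [NeZero.ne d])

/-- The pure state `ρ_w`, i.e. the orthogonal projection `|w⟩⟨w| / ‖w‖²` on `span {w}`. -/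
def pureState (w : Hilb d) (hw : w ≠ 0) : State d :=
  normState (Matrix.vecMulVec w.ofLp (star w.ofLp)) (Matrix.posSemidef_vecMulVec_self_star _) (by
    rw [Matrix.trace_vecMulVec]
    simpa [dotProduct_star_self_eq_zero] using hw)

/-- `ρ ∈ 𝒮(Θ)`: the image of `ρ` is contained in `Θ`. -/
def SupportedOn (Θ : Submodule ℂ (Hilb d)) (ρ : State d) : Prop :=
  LinearMap.range (Matrix.toEuclideanLin ρ.1) ≤ Θ

/-- The pure states of `𝒮(Θ)`. -/
def PureOn (Θ : Submodule ℂ (Hilb d)) (ρ : State d) : Prop :=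
  SupportedOn Θ ρ ∧ ∃ (w : Hilb d) (hw : w ≠ 0), ρ = pureState w hw

/-- The mixed states of `𝒮(Θ)`, i.e. those that are not pure. -/
def MixedOn (Θ : Submodule ℂ (Hilb d)) (ρ : State d) : Prop :=
  SupportedOn Θ ρ ∧ ¬ PureOn Θ ρ

/-! ### Projective measurements and the PIFS of evolution and measurement -/

/-- A projection valued measure on `ℂ^d` with `k` outcomes: non-zero orthogonal projections
that add up to the identity. -/
structure PVM (d k : ℕ) where
  proj : Fin k → Matrix (Fin d) (Fin d) ℂ
  isHermitian : ∀ i, (proj i).IsHermitian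
  idem : ∀ i, proj i * proj i = proj i
  ne_zero : ∀ i, proj i ≠ 0
  sum_proj : ∑ i, proj i = 1

namespace PVM

variable (M : PVM d k)

theorem posSemidef (i : Fin k) : (M.proj i).PosSemidef := by
  have h := Matrix.posSemidef_self_mul_conjTranspose (M.proj i)
  rwa [(M.isHermitian i).eq, M.idem] at h

/-- The image of the projection `M.proj i`. -/
def im (i : Fin k) : Submodule ℂ (Hilb d) := LinearMap.range (Matrix.toEuclideanLin (M.proj i))

/-- The maximally mixed state of `𝒮(im Π_i)`, namely `Π_i / rank Π_i`
(the trace of a projection is its rank). -/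
def maxMixedOn (i : Fin k) : State d :=
  normState (M.proj i) (M.posSemidef i) (fun h => M.ne_zero i ((M.posSemidef i).trace_eq_zero_iff.1 h))

end PVM

/-- The compression `Π_i U|_Θ` of `U` to `Θ = im Π_i`, as a linear endomorphism of `Θ`. -/
def compression (U : Matrix.unitaryGroup (Fin d) ℂ) (M : PVM d k) (i : Fin k) :
    M.im i →ₗ[ℂ] M.im i :=
  (Matrix.toEuclideanLin (M.proj i)).rangeRestrict ∘ₗ Matrix.toEuclideanLin U.1 ∘ₗ
    (M.im i).subtype

/-- The unnormalised state `Π_i U ρ U* Π_i` after the unitary evolution and outcome `i`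
(for a projection, `√Π_i = Π_i`). -/
def unnorm (U : Matrix.unitaryGroup (Fin d) ℂ) (M : PVM d k) (i : Fin k) (ρ : State d) :
    Matrix (Fin d) (Fin d) ℂ :=
  M.proj i * (U.1 * ρ.1 * U.1ᴴ) * M.proj i

/-- The Born probability `tr (Π_i U ρ U*)` of outcome `i`. -/
def born (U : Matrix.unitaryGroup (Fin d) ℂ) (M : PVM d k) (i : Fin k) (ρ : State d) : ℝ :=
  (M.proj i * (U.1 * ρ.1 * U.1ᴴ)).trace.re

theorem unnorm_posSemidef (U : Matrix.unitaryGroup (Fin d) ℂ) (M : PVM d k) (i : Fin k)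
    (ρ : State d) : (unnorm U M i ρ).PosSemidef := by
  have h := (ρ.2.1.mul_mul_conjTranspose_same U.1).mul_mul_conjTranspose_same (M.proj i)
  rwa [(M.isHermitian i).eq] at h

theorem unnorm_trace (U : Matrix.unitaryGroup (Fin d) ℂ) (M : PVM d k) (i : Fin k)
    (ρ : State d) :
    (unnorm U M i ρ).trace = (M.proj i * (U.1 * ρ.1 * U.1ᴴ)).trace := by
  rw [unnorm, Matrix.trace_mul_comm, ← mul_assoc, M.idem]

theorem born_nonneg (U : Matrix.unitaryGroup (Fin d) ℂ) (M : PVM d k) (i : Fin k)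
    (ρ : State d) : 0 ≤ born U M i ρ := by
  rw [born, ← unnorm_trace]
  exact (Complex.le_def.1 (unnorm_posSemidef U M i ρ).trace_nonneg).1

theorem born_sum (U : Matrix.unitaryGroup (Fin d) ℂ) (M : PVM d k) (ρ : State d) :
    ∑ i, born U M i ρ = 1 := by
  have hU : U.1ᴴ * U.1 = 1 := Matrix.mem_unitaryGroup_iff'.1 U.2
  simp only [born]
  rw [← Complex.re_sum, ← Matrix.trace_sum, ← Finset.sum_mul, M.sum_proj, one_mul,
    Matrix.trace_mul_comm, ← mul_assoc, hU, one_mul, ρ.2.2, Complex.one_re]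

/-- The PIFS generated by the unitary `U` and the projective measurement `M`:
`p_i ρ = tr (Π_i U ρ U*)` and `F_i ρ = Π_i U ρ U* Π_i / tr (Π_i U ρ U*)`. -/
def pifs (U : Matrix.unitaryGroup (Fin d) ℂ) (M : PVM d k) : PIFS k (State d) where
  p := born U M
  p_nonneg := born_nonneg U M
  p_le_one i ρ := by
    rw [← born_sum U M ρ]
    exact Finset.single_le_sum (f := fun j => born U M j ρ)
      (fun j _ => born_nonneg U M j ρ) (Finset.mem_univ i)
  sum_p := born_sum U M
  F i ρ := normState (unnorm U M i ρ.1) (unnorm_posSemidef U M i ρ.1) (fun h => by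
    have h2 := ρ.2
    rw [born, ← unnorm_trace, h] at h2
    simp at h2)

/-- The pure state `ρ_e` of an eigenvector `e` of an endomorphism of a subspace `Θ` of `ℂ^d`. -/
def eigenState {Θ : Submodule ℂ (Hilb d)} {A : Module.End ℂ Θ} {c : ℂ} {e : Θ}
    (he : A.HasEigenvector c e) : State d :=
  pureState (e : Hilb d) (fun h => he.2 (Subtype.ext h))

/-! ### The types of chains -/

/-- `ψ = Arg (l₂ / l₁)`, with values in `(-π, π]`. -/
def angle (l₁ l₂ : ℂ) : ℝ := Complex.arg (l₂ / l₁)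

/-- The angle `t` is commensurable with `π`, i.e. `t ∈ π ℚ`. -/
def Commensurable (t : ℝ) : Prop := ∃ q : ℚ, t = Real.pi * q

/-- The eight types of chains. -/
inductive ChainType
  | generic
  | taupek
  | infElliptic
  | finElliptic
  | genericNull
  | taupekNull
  | doubleNull
  | unitary

/-- The condition on the eigenvalues `l₁`, `l₂` (with `‖l₂‖ ≤ ‖l₁‖`) that specifies each type. -/
def ChainType.Cond : ChainType → ℂ → ℂ → Prop
  | generic, l₁, l₂ => (0 < ‖l₂‖ ∧ ‖l₂‖ < ‖l₁‖ ∧ ‖l₁‖ < 1) ∨ (l₁ = l₂ ∧ 0 < ‖l₁‖ ∧ ‖l₁‖ < 1)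
  | taupek, l₁, l₂ => 0 < ‖l₂‖ ∧ ‖l₂‖ < ‖l₁‖ ∧ ‖l₁‖ = 1
  | infElliptic, l₁, l₂ =>
      0 < ‖l₂‖ ∧ ‖l₂‖ = ‖l₁‖ ∧ ‖l₁‖ < 1 ∧ ¬ Commensurable (angle l₁ l₂)
  | finElliptic, l₁, l₂ =>
      0 < ‖l₂‖ ∧ ‖l₂‖ = ‖l₁‖ ∧ ‖l₁‖ < 1 ∧ Commensurable (angle l₁ l₂) ∧ angle l₁ l₂ ≠ 0
  | genericNull, l₁, l₂ => l₂ = 0 ∧ 0 < ‖l₁‖ ∧ ‖l₁‖ < 1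
  | taupekNull, l₁, l₂ => l₂ = 0 ∧ ‖l₁‖ = 1
  | doubleNull, l₁, l₂ => l₂ = 0 ∧ l₁ = 0
  | unitary, l₁, l₂ => ‖l₂‖ = ‖l₁‖ ∧ ‖l₁‖ = 1

/-- Circular chains: the finite-elliptic ones with `ψ = π`. -/
def IsCircular (l₁ l₂ : ℂ) : Prop :=
  ChainType.finElliptic.Cond l₁ l₂ ∧ angle l₁ l₂ = Real.pi

end QPIFS

end

noncomputable section

namespace QPIFS

/-! ### States lifted along an isometry -/

/-! Outcome `1` is the rank one projection `z z*`, so it resets every state to `ρz`, while outcome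
`0` never produces `ρz`. The chain is therefore governed by the orbits of `ρz` and `ρm` under `F 0`.
Take an orthonormal basis of `Θ` whose first vector is proportional to `e₁`, and let `W` be the
isometry with these columns. On states in `Θ`, `F 0` is `σ ↦ A σ A*` up to normalisation, where `A =
W* U W = !![l₁, b; 0, l₂]`. In these coordinates `ρm` is the identity and `v` is `(v₁, v₂)`.

Bordering `A` by `z` gives a unitary 3 × 3 matrix, and orthonormality of its rows and columns
decides the degenerate cases (`UnitaryEntries`). If `‖l₁‖ = 1`, then `b = v₁ = 0`. If `‖l₁‖ < 1`,
then `b ≠ 0` and `v` is not an eigenvector of `A`. If `l₂ = 0`, then `ω = 0`.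

The off-diagonal entry of `A ^ k` is `b` times the divided difference `D k = (l₁ ^ k - l₂ ^ k) / (l₁
- l₂)`. For invertible `A` and `‖l₁‖ < 1`, both orbits return after `k` steps exactly when `D k =
0`, that is, when `A ^ k` is scalar (`conj_triangular_pow_one_iff`,
`conj_triangular_pow_vecMulVec_iff`). For positive `k` this never happens in the generic case, and
for distinct eigenvalues of equal modulus it means `(l₂ / l₁) ^ k = 1`. Convergence holds because `A
^ n`, suitably rescaled, tends to a rank one matrix with range spanned by `e₁`. Almost periodicity
holds because `A ^ n / l₁ ^ n` is an affine function of `(l₂ / l₁) ^ n`, a rotation of the circle.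
In the null cases `A` itself has range in the line of `e₁`. -/

theorem normState_val {d : ℕ} (M : Matrix (Fin d) (Fin d) ℂ) (hM : M.PosSemidef)
    (h : M.trace ≠ 0) : (normState M hM h).1 = M.trace⁻¹ • M := rfl

/-- A state is a ray of positive semi-definite matrices. The scalar may be any complex number: the
traces determine it. This lets all later computations ignore normalisation. -/
theorem normState_eq_iff {d : ℕ} {M N : Matrix (Fin d) (Fin d) ℂ} {hM : M.PosSemidef}
    {hN : N.PosSemidef} {hM0 : M.trace ≠ 0} {hN0 : N.trace ≠ 0} :
    normState M hM hM0 = normState N hN hN0 ↔ ∃ c : ℂ, M = c • N := by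
  rw [Subtype.ext_iff, normState_val, normState_val]
  constructor
  · intro h
    refine ⟨M.trace * N.trace⁻¹, ?_⟩
    rw [mul_smul, ← h, smul_smul, mul_inv_cancel₀ hM0, one_smul]
  · rintro ⟨c, rfl⟩
    have hc : c ≠ 0 := by
      rintro rfl
      simp at hM0
    rw [Matrix.trace_smul, smul_smul, smul_eq_mul, mul_inv, mul_right_comm,
      inv_mul_cancel₀ hc, one_mul]

section Lift

variable {d r k : ℕ}

theorem trace_lift {W : Matrix (Fin d) (Fin r) ℂ} (hW : Wᴴ * W = 1)
    (σ : Matrix (Fin r) (Fin r) ℂ) : (W * σ * Wᴴ).trace = σ.trace := by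
  rw [Matrix.trace_mul_comm, ← Matrix.mul_assoc, hW, Matrix.one_mul]

theorem lift_inj {W : Matrix (Fin d) (Fin r) ℂ} (hW : Wᴴ * W = 1)
    {σ τ : Matrix (Fin r) (Fin r) ℂ} (h : W * σ * Wᴴ = W * τ * Wᴴ) : σ = τ := by
  have key : ∀ σ : Matrix (Fin r) (Fin r) ℂ, Wᴴ * (W * σ * Wᴴ) * W = σ := fun σ => by
    rw [Matrix.mul_assoc, Matrix.mul_assoc, Matrix.mul_assoc, hW, Matrix.mul_one,
      ← Matrix.mul_assoc, hW, Matrix.one_mul]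
  rw [← key σ, h, key]

/-- The state `W σ W* / tr σ`, for an isometry `W` and a non-zero positive semi-definite `σ`. -/
def liftState {W : Matrix (Fin d) (Fin r) ℂ} (hW : Wᴴ * W = 1) (σ : Matrix (Fin r) (Fin r) ℂ)
    (hσ : σ.PosSemidef) (h0 : σ ≠ 0) : State d :=
  normState (W * σ * Wᴴ) (hσ.mul_mul_conjTranspose_same W) (by
    rw [trace_lift hW]
    exact fun h => h0 (hσ.trace_eq_zero_iff.1 h))

variable {W : Matrix (Fin d) (Fin r) ℂ} {hW : Wᴴ * W = 1}

theorem liftState_val {σ : Matrix (Fin r) (Fin r) ℂ} (hσ : σ.PosSemidef) (h0 : σ ≠ 0) :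
    (liftState hW σ hσ h0).1 = σ.trace⁻¹ • (W * σ * Wᴴ) := by
  rw [liftState, normState_val, trace_lift hW]

theorem liftState_eq_iff {σ τ : Matrix (Fin r) (Fin r) ℂ} {hσ : σ.PosSemidef} {hσ0 : σ ≠ 0}
    {hτ : τ.PosSemidef} {hτ0 : τ ≠ 0} :
    liftState hW σ hσ hσ0 = liftState hW τ hτ hτ0 ↔ ∃ c : ℂ, σ = c • τ := by
  rw [liftState, liftState, normState_eq_iff]
  refine exists_congr fun c => ⟨fun h => lift_inj hW ?_, fun h => ?_⟩
  · rw [h, Matrix.mul_smul, Matrix.smul_mul]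
  · rw [h, Matrix.mul_smul, Matrix.smul_mul]

theorem vecMulVec_star_ne_zero {n : ℕ} {x : Fin n → ℂ} (hx : x ≠ 0) :
    Matrix.vecMulVec x (star x) ≠ 0 := by
  intro h
  apply hx
  ext i
  simpa [Matrix.vecMulVec_apply] using congrFun (congrFun h i) i

theorem mul_vecMulVec_mul {m n : ℕ} (B : Matrix (Fin m) (Fin n) ℂ) (x : Fin n → ℂ) :
    B * Matrix.vecMulVec x (star x) * Bᴴ = Matrix.vecMulVec (B *ᵥ x) (star (B *ᵥ x)) := by
  rw [Matrix.mul_vecMulVec, Matrix.vecMulVec_mul, Matrix.star_mulVec]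

theorem pureState_eq_liftState (w : Hilb d) (hw : w ≠ 0) (x : Fin r → ℂ) (hx : x ≠ 0)
    (h : w.ofLp = W *ᵥ x) :
    pureState w hw = liftState hW (Matrix.vecMulVec x (star x))
      (Matrix.posSemidef_vecMulVec_self_star x) (vecMulVec_star_ne_zero hx) := by
  rw [pureState, liftState, normState_eq_iff]
  exact ⟨1, by rw [mul_vecMulVec_mul, h, one_smul]⟩

variable {M : PVM d k} {i : Fin k}

theorem supportedOn_liftState (hP : W * Wᴴ = M.proj i) {σ : Matrix (Fin r) (Fin r) ℂ}
    (hσ : σ.PosSemidef) (h0 : σ ≠ 0) : SupportedOn (M.im i) (liftState hW σ hσ h0) := by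
  rintro _ ⟨x, rfl⟩
  have h : M.proj i * (liftState hW σ hσ h0).1 = (liftState hW σ hσ h0).1 := by
    rw [liftState_val, ← hP, Matrix.mul_smul, Matrix.mul_assoc, ← Matrix.mul_assoc Wᴴ,
      ← Matrix.mul_assoc Wᴴ, hW, Matrix.one_mul, ← Matrix.mul_assoc]
  refine ⟨Matrix.toEuclideanLin (liftState hW σ hσ h0).1 x, ?_⟩
  rw [Matrix.toLpLin_apply, Matrix.toLpLin_apply, Matrix.mulVec_mulVec, h]

theorem pureOn_liftState (hP : W * Wᴴ = M.proj i) {x : Fin r → ℂ} (hx : x ≠ 0)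
    {σ : Matrix (Fin r) (Fin r) ℂ} (hσ : σ.PosSemidef) (h0 : σ ≠ 0)
    (h : σ = Matrix.vecMulVec x (star x)) : PureOn (M.im i) (liftState hW σ hσ h0) := by
  refine ⟨supportedOn_liftState hP hσ h0, WithLp.toLp 2 (W *ᵥ x), ?_, ?_⟩
  · intro h
    apply hx
    have h' : W *ᵥ x = 0 := by simpa using h
    rw [← Matrix.one_mulVec x, ← hW, ← Matrix.mulVec_mulVec, h', Matrix.mulVec_zero]
  · rw [pureState_eq_liftState (hW := hW) _ _ x hx rfl, liftState_eq_iff]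
    exact ⟨1, by rw [h, one_smul]⟩

/-- In the two coordinates of `W` a pure state is a multiple of some `x x*`, which is singular. -/
theorem mixedOn_liftState {W : Matrix (Fin d) (Fin 2) ℂ} {hW : Wᴴ * W = 1}
    (hP : W * Wᴴ = M.proj i) {σ : Matrix (Fin 2) (Fin 2) ℂ}
    (hσ : σ.PosSemidef) (h0 : σ ≠ 0) (hdet : σ.det ≠ 0) :
    MixedOn (M.im i) (liftState hW σ hσ h0) := by
  refine ⟨supportedOn_liftState hP hσ h0, ?_⟩
  rintro ⟨-, w, hw, h⟩
  obtain ⟨c, hc⟩ := normState_eq_iff.1 h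
  apply hdet
  have h2 : σ = c • Matrix.vecMulVec (Wᴴ *ᵥ w.ofLp) (star (Wᴴ *ᵥ w.ofLp)) := by
    rw [← mul_vecMulVec_mul, ← Matrix.smul_mul, ← Matrix.mul_smul, ← hc,
      Matrix.conjTranspose_conjTranspose, Matrix.mul_assoc, Matrix.mul_assoc, Matrix.mul_assoc,
      hW, Matrix.mul_one, ← Matrix.mul_assoc, hW, Matrix.one_mul]
  rw [h2, Matrix.det_fin_two]
  simp [Matrix.vecMulVec_apply]
  ring

variable {U : Matrix.unitaryGroup (Fin d) ℂ} {A : Matrix (Fin r) (Fin r) ℂ}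

/-- Writing both copies of `Π_i` as `W W*` regroups the product around `W* U W`. -/
theorem unnorm_liftState (hP : W * Wᴴ = M.proj i) (hA : A = Wᴴ * U.1 * W)
    {σ : Matrix (Fin r) (Fin r) ℂ} (hσ : σ.PosSemidef) (h0 : σ ≠ 0) :
    unnorm U M i (liftState hW σ hσ h0) = σ.trace⁻¹ • (W * (A * σ * Aᴴ) * Wᴴ) := by
  rw [unnorm, liftState_val, ← hP, hA]
  simp only [Matrix.mul_smul, Matrix.smul_mul, Matrix.conjTranspose_mul,
    Matrix.conjTranspose_conjTranspose, Matrix.mul_assoc]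

theorem born_liftState (hP : W * Wᴴ = M.proj i) (hA : A = Wᴴ * U.1 * W)
    {σ : Matrix (Fin r) (Fin r) ℂ} (hσ : σ.PosSemidef) (h0 : σ ≠ 0) :
    (pifs U M).p i (liftState hW σ hσ h0) = (σ.trace⁻¹ * (A * σ * Aᴴ).trace).re := by
  change born U M i _ = _
  rw [born, ← unnorm_trace, unnorm_liftState hP hA, Matrix.trace_smul, trace_lift hW, smul_eq_mul]

/-- `F_i ρ = N / tr N` as soon as `Π_i U ρ U* Π_i` is a non-zero multiple of `N`. -/
theorem maps_normState {ρ : State d} {N : Matrix (Fin d) (Fin d) ℂ} (hN : N.PosSemidef)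
    (hN0 : N.trace ≠ 0) {c : ℂ} (hc : c ≠ 0) (h : unnorm U M i ρ = c • N) :
    (pifs U M).Maps i ρ (normState N hN hN0) := by
  have htr : (unnorm U M i ρ).trace ≠ 0 := by
    rw [h, Matrix.trace_smul, smul_eq_mul]
    exact mul_ne_zero hc hN0
  have hpos : 0 < (pifs U M).p i ρ := by
    refine lt_of_le_of_ne ((pifs U M).p_nonneg i ρ) fun h0 => htr ?_
    have h1 := (unnorm_posSemidef U M i ρ).trace_nonneg
    change 0 = born U M i ρ at h0
    rw [born, ← unnorm_trace] at h0
    exact Complex.ext h0.symm (Complex.le_def.1 h1).2.symm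
  exact ⟨hpos, (normState_eq_iff (hM := unnorm_posSemidef U M i ρ) (hM0 := htr)).2 ⟨c, h⟩⟩

theorem maps_liftState (hP : W * Wᴴ = M.proj i) (hA : A = Wᴴ * U.1 * W)
    {σ τ : Matrix (Fin r) (Fin r) ℂ} (hσ : σ.PosSemidef) (hσ0 : σ ≠ 0) (hτ : τ.PosSemidef)
    (hτ0 : τ ≠ 0) {c : ℂ} (hc : c ≠ 0) (h : A * σ * Aᴴ = c • τ) :
    (pifs U M).Maps i (liftState hW σ hσ hσ0) (liftState hW τ hτ hτ0) := by
  refine maps_normState _ _ (c := σ.trace⁻¹ * c)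
    (mul_ne_zero (inv_ne_zero fun h => hσ0 (hσ.trace_eq_zero_iff.1 h)) hc) ?_
  rw [unnorm_liftState hP hA, h, Matrix.mul_smul, Matrix.smul_mul, smul_smul]

theorem conj_ne_zero {A σ : Matrix (Fin r) (Fin r) ℂ} (hA : IsUnit A) (hσ : σ ≠ 0) :
    A * σ * Aᴴ ≠ 0 := by
  intro h
  have hA' : IsUnit Aᴴ := by
    simpa [Matrix.star_eq_conjTranspose] using hA.star
  exact hσ ((hA.mul_right_eq_zero).1 ((hA'.mul_left_eq_zero).1 h))

/-- The trajectory of `σ` under conjugation by the powers of an invertible matrix. -/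
def orbitState (hW : Wᴴ * W = 1) {A : Matrix (Fin r) (Fin r) ℂ} (hA : IsUnit A)
    {σ : Matrix (Fin r) (Fin r) ℂ} (hσ : σ.PosSemidef) (h0 : σ ≠ 0) (n : ℕ) : State d :=
  liftState hW (A ^ n * σ * (A ^ n)ᴴ) (hσ.mul_mul_conjTranspose_same _)
    (conj_ne_zero (hA.pow n) h0)

theorem isTrajectory_orbitState (hP : W * Wᴴ = M.proj i) (hA : A = Wᴴ * U.1 * W)
    (hu : IsUnit A) {σ : Matrix (Fin r) (Fin r) ℂ} (hσ : σ.PosSemidef) (h0 : σ ≠ 0) :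
    (pifs U M).IsTrajectory i (liftState hW σ hσ h0) (orbitState hW hu hσ h0) := by
  refine ⟨liftState_eq_iff.2 ⟨1, by simp⟩, fun n => ?_⟩
  refine maps_liftState hP hA _ _ _ _ one_ne_zero ?_
  rw [one_smul, pow_succ', Matrix.conjTranspose_mul]
  simp only [Matrix.mul_assoc]

/-- Conjugation by the invertible `A ^ n` cancels on both sides, so whether a return takes `k` steps
does not depend on where in the orbit one starts. -/
theorem orbitState_add_eq_iff (hu : IsUnit A) {σ : Matrix (Fin r) (Fin r) ℂ}
    (hσ : σ.PosSemidef) (h0 : σ ≠ 0) (n k : ℕ) :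
    orbitState hW hu hσ h0 (n + k) = orbitState hW hu hσ h0 n ↔
      ∃ c : ℂ, A ^ k * σ * (A ^ k)ᴴ = c • σ := by
  rw [orbitState, orbitState, liftState_eq_iff]
  refine exists_congr fun c => ?_
  have hn := hu.pow n
  have hn' : IsUnit (A ^ n)ᴴ := by
    simpa [Matrix.star_eq_conjTranspose] using hn.star
  have e : A ^ (n + k) * σ * (A ^ (n + k))ᴴ = A ^ n * (A ^ k * σ * (A ^ k)ᴴ) * (A ^ n)ᴴ := by
    rw [pow_add, Matrix.conjTranspose_mul]
    simp only [Matrix.mul_assoc]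
  have e' : c • (A ^ n * σ * (A ^ n)ᴴ) = A ^ n * (c • σ) * (A ^ n)ᴴ := by
    rw [Matrix.mul_smul, Matrix.smul_mul]
  rw [e, e']
  exact ⟨fun h => hn.mul_left_cancel (hn'.mul_right_cancel h), fun h => by rw [h]⟩

/-- The normalised state of `g σ g*` is unchanged when `g` is rescaled and is continuous in `g`
wherever `g σ g* ≠ 0`. Hence it suffices that suitable multiples of `A ^ n` converge, even to a
singular `B`, as long as `B σ B* ≠ 0`. -/
theorem tendsto_orbitState (hu : IsUnit A) {σ τ : Matrix (Fin r) (Fin r) ℂ}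
    (hσ : σ.PosSemidef) (h0 : σ ≠ 0) (hτ : τ.PosSemidef) (hτ0 : τ ≠ 0) {a : ℕ → ℂ}
    (ha : ∀ᶠ n in atTop, a n ≠ 0) {B : Matrix (Fin r) (Fin r) ℂ}
    (hB : Tendsto (fun n => (a n)⁻¹ • A ^ n) atTop (𝓝 B)) {c : ℂ} (hc : c ≠ 0)
    (h : B * σ * Bᴴ = c • τ) :
    Tendsto (orbitState hW hu hσ h0) atTop (𝓝 (liftState hW τ hτ hτ0)) := by
  rw [tendsto_subtype_rng, liftState_val]
  have htr : τ.trace ≠ 0 := fun h => hτ0 (hτ.trace_eq_zero_iff.1 h)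
  let Φ : Matrix (Fin r) (Fin r) ℂ → Matrix (Fin d) (Fin d) ℂ := fun g =>
    (g * σ * gᴴ).trace⁻¹ • (W * (g * σ * gᴴ) * Wᴴ)
  have hΦ : ContinuousAt Φ B := by
    have h1 : Continuous fun g : Matrix (Fin r) (Fin r) ℂ => (g * σ * gᴴ).trace := by fun_prop
    have h2 : Continuous fun g : Matrix (Fin r) (Fin r) ℂ => W * (g * σ * gᴴ) * Wᴴ := by
      fun_prop
    refine (h1.continuousAt.inv₀ ?_).smul h2.continuousAt
    rw [h, Matrix.trace_smul, smul_eq_mul]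
    exact mul_ne_zero hc htr
  have hB' : Φ B = τ.trace⁻¹ • (W * τ * Wᴴ) := by
    simp only [Φ]
    rw [h, Matrix.trace_smul, Matrix.mul_smul, Matrix.smul_mul, smul_smul, smul_eq_mul, mul_inv,
      mul_right_comm, inv_mul_cancel₀ hc, one_mul]
  rw [← hB']
  refine (hΦ.tendsto.comp hB).congr' ?_
  filter_upwards [ha] with n hn
  simp only [Function.comp, Φ]
  rw [orbitState, liftState_val]
  have hs : star (a n) ≠ 0 := star_ne_zero.2 hn
  rw [Matrix.conjTranspose_smul, Matrix.smul_mul, Matrix.smul_mul, Matrix.mul_smul, smul_smul,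
    Matrix.trace_smul, Matrix.mul_smul, Matrix.smul_mul, smul_smul, smul_eq_mul, mul_inv]
  -- The factor `|a n|⁻²` cancels between the matrix and its trace.
  congr 1
  rw [mul_right_comm, inv_mul_cancel₀, one_mul]
  rw [star_inv₀]
  exact mul_ne_zero (inv_ne_zero hn) (inv_ne_zero hs)

end Lift

/-! ### Almost periodicity -/

/-- By compactness of the circle, finitely many powers `r ^ f y` with exponents at most `J`
approximate all powers, and some `P ≥ J` has `r ^ P` close to `1`. If `r ^ n` is close to `r ^ f y`,
waiting `P - f y` more steps leads close to `r ^ P`, hence to `1`, and `m` further steps lead close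
to `r ^ m`. The total wait is at most `P + m`. -/
theorem pow_uniformly_recurrent {r : ℂ} (hr : ‖r‖ = 1) {ε : ℝ} (hε : 0 < ε) (m : ℕ) :
    ∃ L : ℕ, ∀ n, ∃ j ≤ L, ‖r ^ (n + j) - r ^ m‖ < ε := by
  have hpow : ∀ n : ℕ, ‖r ^ n‖ = 1 := fun n => by rw [norm_pow, hr, one_pow]
  have hcomp : IsCompact (Metric.sphere (0 : ℂ) 1) := isCompact_sphere 0 1
  have htb : TotallyBounded (Set.range fun n : ℕ => r ^ n) :=
    hcomp.totallyBounded.subset (by rintro _ ⟨n, rfl⟩; simpa using hpow n)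
  obtain ⟨t, hts, htfin, hcov⟩ := htb.exists_subset (Metric.dist_mem_uniformity (half_pos hε))
  have hts' : ∀ y ∈ t, ∃ n : ℕ, r ^ n = y := fun y hy => hts hy
  choose! f hf using hts'
  obtain ⟨J, hJ⟩ := (htfin.image f).bddAbove
  obtain ⟨P, hPJ, hP⟩ : ∃ P, J ≤ P ∧ ‖r ^ P - 1‖ < ε / 2 := by
    obtain ⟨a, -, φ, hφ, hlim⟩ := hcomp.tendsto_subseq (x := fun n : ℕ => r ^ n)
      (fun n => by simpa using hpow n)
    -- Two close terms `r ^ φ (J + N)` and `r ^ φ N` have a quotient close to `1`. Strict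
    -- monotonicity of `φ` makes the difference of the exponents at least `J`.
    obtain ⟨N, hN⟩ := Metric.cauchySeq_iff.1 hlim.cauchySeq (ε / 2) (half_pos hε)
    have hle := hφ.add_le_nat J N
    refine ⟨φ (J + N) - φ N, by omega, ?_⟩
    have h := hN (J + N) (by omega) N le_rfl
    simp only [Function.comp, dist_eq_norm] at h
    have e : r ^ φ (J + N) - r ^ φ N = r ^ φ N * (r ^ (φ (J + N) - φ N) - 1) := by
      rw [mul_sub, ← pow_add, mul_one]
      congr 2
      omega
    rwa [e, norm_mul, hpow, one_mul] at h
  refine ⟨P + m, fun n => ?_⟩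
  obtain ⟨y, hy, hny⟩ := Set.mem_iUnion₂.1 (hcov ⟨n, rfl⟩)
  have hfy : f y ≤ J := hJ ⟨y, hy, rfl⟩
  have hdist : ‖r ^ n - r ^ f y‖ < ε / 2 := by
    have h : dist (r ^ n) y < ε / 2 := hny
    rwa [← hf y hy, dist_eq_norm] at h
  refine ⟨P - f y + m, by omega, ?_⟩
  have e : r ^ (n + (P - f y + m)) - r ^ m =
      (r ^ n - r ^ f y) * r ^ (P - f y + m) + r ^ m * (r ^ P - 1) := by
    have h1 : r ^ P = r ^ f y * r ^ (P - f y) := by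
      rw [← pow_add]
      congr 1
      omega
    rw [h1]
    ring
  rw [e]
  calc _ ≤ _ := norm_add_le _ _
    _ < ε / 2 + ε / 2 := by
      rw [norm_mul, norm_mul, hpow, hpow, mul_one, one_mul]
      exact add_lt_add hdist hP
    _ = ε := add_halves ε

theorem almostPeriodic_of_rotation {X : Type*} [TopologicalSpace X] {r : ℂ} (hr : ‖r‖ = 1)
    {Φ : ℂ → X} (hΦ : ∀ n : ℕ, ContinuousAt Φ (r ^ n)) : AlmostPeriodic fun n => Φ (r ^ n) := by
  intro m V hV
  obtain ⟨ε, hε, hball⟩ := Metric.mem_nhds_iff.1 ((hΦ m).preimage_mem_nhds hV)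
  obtain ⟨L, hL⟩ := pow_uniformly_recurrent hr hε m
  refine ⟨L, fun n => ?_⟩
  obtain ⟨j, hj, h⟩ := hL n
  exact ⟨j, hj, hball (by rwa [Metric.mem_ball, dist_eq_norm])⟩

theorem almostPeriodic_subtype {X : Type*} [TopologicalSpace X] {p : X → Prop}
    {s : ℕ → Subtype p} (h : AlmostPeriodic fun n => (s n).1) : AlmostPeriodic s := by
  intro m V hV
  obtain ⟨V', hV', hsub⟩ := mem_nhds_subtype _ _ _ |>.1 hV
  obtain ⟨L, hL⟩ := h m V' hV'
  exact ⟨L, fun n => (hL n).imp fun j hj => ⟨hj.1, hsub hj.2⟩⟩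

/-! ### Orbits of states under upper triangular matrices -/

section Orbit

variable {d r : ℕ} {W : Matrix (Fin d) (Fin r) ℂ} {hW : Wᴴ * W = 1}
  {A : Matrix (Fin r) (Fin r) ℂ}

theorem orbitState_injective (hu : IsUnit A) {σ : Matrix (Fin r) (Fin r) ℂ}
    (hσ : σ.PosSemidef) (h0 : σ ≠ 0)
    (h : ∀ k, 0 < k → ¬ ∃ c : ℂ, A ^ k * σ * (A ^ k)ᴴ = c • σ) :
    Function.Injective (orbitState hW hu hσ h0) := by
  refine Function.Injective.of_lt_imp_ne fun m n hmn heq => ?_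
  obtain ⟨k, rfl⟩ := Nat.exists_eq_add_of_lt hmn
  rw [add_assoc] at heq
  exact h (k + 1) k.succ_pos ((orbitState_add_eq_iff hu hσ h0 m (k + 1)).1 heq.symm)

theorem orbitState_periodic (hu : IsUnit A) {σ : Matrix (Fin r) (Fin r) ℂ}
    (hσ : σ.PosSemidef) (h0 : σ ≠ 0) {κ : ℕ} (hκ : 0 < κ)
    (h : ∀ k, (∃ c : ℂ, A ^ k * σ * (A ^ k)ᴴ = c • σ) ↔ κ ∣ k) :
    PeriodicWithPeriod (orbitState hW hu hσ h0) κ := by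
  refine ⟨hκ, fun m n => ?_⟩
  have key : ∀ m k, orbitState hW hu hσ h0 (m + k) = orbitState hW hu hσ h0 m ↔
      m ≡ m + k [MOD κ] := fun m k => by
    rw [orbitState_add_eq_iff, h, Nat.modEq_iff_dvd' (Nat.le_add_right m k),
      Nat.add_sub_cancel_left]
  rcases le_total m n with hmn | hmn <;> obtain ⟨k, rfl⟩ := Nat.exists_eq_add_of_le hmn
  · rw [eq_comm, key]
  · rw [key, Nat.ModEq.comm]

end Orbit

/-- The divided difference `(x ^ k - y ^ k) / (x - y)`. -/
def divDiff (x y : ℂ) (k : ℕ) : ℂ := ∑ i ∈ Finset.range k, x ^ i * y ^ (k - 1 - i)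

theorem divDiff_mul (x y : ℂ) (k : ℕ) : divDiff x y k * (x - y) = x ^ k - y ^ k :=
  geom_sum₂_mul x y k

theorem divDiff_self (x : ℂ) (k : ℕ) : divDiff x x k = k * x ^ (k - 1) := by
  have h : ∀ i ∈ Finset.range k, x ^ i * x ^ (k - 1 - i) = x ^ (k - 1) := fun i hi => by
    rw [← pow_add]
    congr 1
    have := Finset.mem_range.1 hi
    omega
  rw [divDiff, Finset.sum_congr rfl h]
  simp

theorem divDiff_eq_zero_iff {x y : ℂ} (hxy : x ≠ y) (k : ℕ) :
    divDiff x y k = 0 ↔ x ^ k = y ^ k := by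
  rw [← sub_eq_zero (a := x ^ k), ← divDiff_mul, mul_eq_zero, or_iff_left (sub_ne_zero.2 hxy)]

theorem triangular_pow (l₁ l₂ b : ℂ) (k : ℕ) :
    !![l₁, b; 0, l₂] ^ k = !![l₁ ^ k, b * divDiff l₁ l₂ k; 0, l₂ ^ k] := by
  induction k with
  | zero => simp [divDiff, Matrix.one_fin_two]
  | succ k ih =>
    have h : divDiff l₁ l₂ (k + 1) = l₁ ^ k + l₂ * divDiff l₁ l₂ k := geom_sum₂_succ_eq l₁ l₂
    rw [pow_succ, ih, h]
    ext i j
    fin_cases i <;> fin_cases j <;> simp [Matrix.mul_apply, Fin.sum_univ_two] <;> ring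

section Triangular

variable {l₁ l₂ b : ℂ} {k : ℕ}

theorem isUnit_triangular (h₁ : l₁ ≠ 0) (h₂ : l₂ ≠ 0) : IsUnit !![l₁, b; 0, l₂] := by
  rw [Matrix.isUnit_iff_isUnit_det, Matrix.det_fin_two]
  simpa using ⟨h₁, h₂⟩

/-- A vanishing divided difference kills the off-diagonal entry and also forces `l₁ ^ k = l₂ ^ k`,
so the power is scalar and fixes every ray. -/
theorem conj_triangular_pow_of_divDiff_eq_zero (h : divDiff l₁ l₂ k = 0)
    (σ : Matrix (Fin 2) (Fin 2) ℂ) :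
    ∃ c : ℂ, !![l₁, b; 0, l₂] ^ k * σ * (!![l₁, b; 0, l₂] ^ k)ᴴ = c • σ := by
  have h' : l₁ ^ k = l₂ ^ k := by rw [← sub_eq_zero, ← divDiff_mul, h, zero_mul]
  have e : !![l₁, b; 0, l₂] ^ k = l₂ ^ k • (1 : Matrix (Fin 2) (Fin 2) ℂ) := by
    rw [triangular_pow, h, h', Matrix.one_fin_two]
    simp
  refine ⟨l₂ ^ k * star (l₂ ^ k), ?_⟩
  rw [e, Matrix.conjTranspose_smul, Matrix.conjTranspose_one, Matrix.smul_mul, Matrix.mul_smul,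
    Matrix.one_mul, Matrix.mul_one, smul_smul, mul_comm]

/-- The off-diagonal entry of the conjugated identity is `b * divDiff l₁ l₂ k * star (l₂ ^ k)`. -/
theorem conj_triangular_pow_one_iff (hb : b ≠ 0) (h₂ : l₂ ≠ 0) :
    (∃ c : ℂ, !![l₁, b; 0, l₂] ^ k * 1 * (!![l₁, b; 0, l₂] ^ k)ᴴ = c • 1) ↔
      divDiff l₁ l₂ k = 0 := by
  refine ⟨?_, fun h => conj_triangular_pow_of_divDiff_eq_zero h 1⟩
  rintro ⟨c, hc⟩
  rw [triangular_pow] at hc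
  have h01 := congrFun (congrFun hc 0) 1
  simpa [Matrix.mul_apply, Fin.sum_univ_two, hb, h₂] using h01

/-- Covers the taupek case, where `b = 0` and the off-diagonal entry gives no information. The
diagonal entries differ instead: the first is at least `‖l₁‖ ^ (2 * k)`, the second equals `‖l₂‖ ^
(2 * k)`. -/
theorem conj_triangular_pow_one_ne (h : ‖l₂‖ < ‖l₁‖) (hk : 0 < k) :
    ¬ ∃ c : ℂ, !![l₁, b; 0, l₂] ^ k * 1 * (!![l₁, b; 0, l₂] ^ k)ᴴ = c • 1 := by
  rintro ⟨c, hc⟩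
  rw [triangular_pow] at hc
  have h00 := congrFun (congrFun hc 0) 0
  have h11 := congrFun (congrFun hc 1) 1
  simp [Matrix.mul_apply, Fin.sum_univ_two, Complex.mul_conj'] at h00 h11
  have e : (‖l₁ ^ k‖ : ℂ) ^ 2 + (‖b * divDiff l₁ l₂ k‖ : ℂ) ^ 2 = (‖l₂ ^ k‖ : ℂ) ^ 2 := by
    rw [norm_pow, norm_pow, norm_mul]
    push_cast
    rw [h11, ← h00]
  have e' : ‖l₁ ^ k‖ ^ 2 + ‖b * divDiff l₁ l₂ k‖ ^ 2 = ‖l₂ ^ k‖ ^ 2 := by exact_mod_cast e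
  have hlt : ‖l₂ ^ k‖ < ‖l₁ ^ k‖ := by
    rw [norm_pow, norm_pow]
    exact pow_lt_pow_left₀ h (norm_nonneg _) hk.ne'
  nlinarith [norm_nonneg (l₂ ^ k), sq_nonneg ‖b * divDiff l₁ l₂ k‖]

theorem collinear_of_vecMulVec_eq_smul {x y : Fin 2 → ℂ} {c : ℂ}
    (h : Matrix.vecMulVec x (star x) = c • Matrix.vecMulVec y (star y)) :
    x 0 * y 1 - x 1 * y 0 = 0 := by
  have h' : ∀ i j, x i * star (x j) = c * (y i * star (y j)) := fun i j => by
    simpa [Matrix.vecMulVec_apply] using congrFun (congrFun h i) j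
  by_contra hne
  have key : ∀ j, star (x j) = 0 := fun j => by
    have e : (x 0 * y 1 - x 1 * y 0) * star (x j) = 0 := by
      linear_combination y 1 * h' 0 j - y 0 * h' 1 j
    exact (mul_eq_zero.1 e).resolve_left hne
  have h0 := star_eq_zero.1 (key 0)
  have h1 := star_eq_zero.1 (key 1)
  rw [h0, h1] at hne
  simp at hne

/-- With `A` the triangular matrix, the determinant of the pair `A ^ k v`, `v` factors as `v₂ *
divDiff l₁ l₂ k * ((l₁ - l₂) * v₁ + b * v₂)`. For `v₂ ≠ 0`, the hypothesis on the last factor says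
that `v` is not an eigenvector of `A`. -/
theorem conj_triangular_pow_vecMulVec_iff {v₁ v₂ : ℂ} (hv₂ : v₂ ≠ 0)
    (hv : (l₁ - l₂) * v₁ + b * v₂ ≠ 0) :
    (∃ c : ℂ, !![l₁, b; 0, l₂] ^ k * Matrix.vecMulVec ![v₁, v₂] (star ![v₁, v₂]) *
      (!![l₁, b; 0, l₂] ^ k)ᴴ = c • Matrix.vecMulVec ![v₁, v₂] (star ![v₁, v₂])) ↔
      divDiff l₁ l₂ k = 0 := by
  refine ⟨?_, fun h => conj_triangular_pow_of_divDiff_eq_zero h _⟩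
  rintro ⟨c, hc⟩
  rw [mul_vecMulVec_mul, triangular_pow] at hc
  have h := collinear_of_vecMulVec_eq_smul hc
  simp [Matrix.mulVec, dotProduct, Fin.sum_univ_two] at h
  have e : v₂ * (divDiff l₁ l₂ k * ((l₁ - l₂) * v₁ + b * v₂)) = 0 := by
    linear_combination h + v₁ * v₂ * divDiff_mul l₁ l₂ k
  simpa [hv₂, hv] using e

theorem triangular_pow_eq_smul (h₁ : l₁ ≠ 0) (hne : l₁ ≠ l₂) (n : ℕ) :
    !![l₁, b; 0, l₂] ^ n =
      l₁ ^ n • !![1, b / (l₁ - l₂) * (1 - (l₂ / l₁) ^ n); 0, (l₂ / l₁) ^ n] := by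
  have hsub : l₁ - l₂ ≠ 0 := sub_ne_zero.2 hne
  have hd : divDiff l₁ l₂ n = (l₁ ^ n - l₂ ^ n) / (l₁ - l₂) := by
    rw [← divDiff_mul, mul_div_cancel_right₀ _ hsub]
  rw [triangular_pow, hd, div_pow]
  ext i j
  fin_cases i <;> fin_cases j <;> simp <;> field_simp

theorem tendsto_triangular_pow_of_norm_lt (h : ‖l₂‖ < ‖l₁‖) :
    Tendsto (fun n : ℕ => (l₁ ^ n)⁻¹ • !![l₁, b; 0, l₂] ^ n) atTop
      (𝓝 !![1, b / (l₁ - l₂); 0, 0]) := by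
  have h₁ : l₁ ≠ 0 := norm_pos_iff.1 ((norm_nonneg _).trans_lt h)
  have hne : l₁ ≠ l₂ := fun e => by rw [e] at h; exact lt_irrefl _ h
  have hr : Tendsto (fun n : ℕ => (l₂ / l₁) ^ n) atTop (𝓝 0) := by
    apply tendsto_pow_atTop_nhds_zero_of_norm_lt_one
    rwa [norm_div, div_lt_one (norm_pos_iff.2 h₁)]
  have e : ∀ n : ℕ, (l₁ ^ n)⁻¹ • !![l₁, b; 0, l₂] ^ n =
      !![1, b / (l₁ - l₂) * (1 - (l₂ / l₁) ^ n); 0, (l₂ / l₁) ^ n] := fun n => by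
    rw [triangular_pow_eq_smul h₁ hne, smul_smul, inv_mul_cancel₀ (pow_ne_zero n h₁), one_smul]
  simp only [e]
  refine tendsto_pi_nhds.2 fun i => tendsto_pi_nhds.2 fun j => ?_
  fin_cases i <;> fin_cases j <;> simp
  · simpa using (hr.const_sub 1).const_mul (b / (l₁ - l₂))
  · simpa using hr

/-- For a Jordan block the off-diagonal entry `n * l ^ (n - 1) * b` outgrows the diagonal `l ^ n` by
a factor of order `n`, so only it survives. -/
theorem tendsto_triangular_pow_self {l : ℂ} (hl : l ≠ 0) :
    Tendsto (fun n : ℕ => (n * l ^ (n - 1))⁻¹ • !![l, b; 0, l] ^ n) atTop (𝓝 !![0, b; 0, 0]) := by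
  have hr : Tendsto (fun n : ℕ => l / (n : ℂ)) atTop (𝓝 0) :=
    tendsto_const_div_atTop_nhds_zero_nat l
  have e : (fun n : ℕ => (n * l ^ (n - 1))⁻¹ • !![l, b; 0, l] ^ n) =ᶠ[atTop]
      fun n : ℕ => !![l / (n : ℂ), b; 0, l / (n : ℂ)] := by
    filter_upwards [eventually_gt_atTop 0] with n hn
    obtain ⟨m, rfl⟩ := Nat.exists_eq_succ_of_ne_zero hn.ne'
    have hm : ((m.succ : ℕ) : ℂ) ≠ 0 := Nat.cast_ne_zero.2 hn.ne'
    rw [triangular_pow, divDiff_self, Nat.succ_sub_one, Nat.succ_eq_add_one, pow_succ]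
    rw [Nat.succ_eq_add_one] at hm
    ext i j
    fin_cases i <;> fin_cases j <;> simp <;> field_simp
  rw [tendsto_congr' e]
  refine tendsto_pi_nhds.2 fun i => tendsto_pi_nhds.2 fun j => ?_
  fin_cases i <;> fin_cases j <;> simp
  · simpa using hr
  · simpa using hr

theorem vecMulVec_one_zero :
    Matrix.vecMulVec ![1, 0] (star ![1, 0]) = (!![1, 0; 0, 0] : Matrix (Fin 2) (Fin 2) ℂ) := by
  ext i j
  fin_cases i <;> fin_cases j <;> simp [Matrix.vecMulVec_apply]

theorem conj_first_row_one (α β : ℂ) :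
    !![α, β; 0, 0] * 1 * !![α, β; 0, 0]ᴴ =
      (α * star α + β * star β) • Matrix.vecMulVec ![1, 0] (star ![1, 0]) := by
  rw [vecMulVec_one_zero]
  ext i j
  fin_cases i <;> fin_cases j <;>
    simp [Matrix.mul_apply, Fin.sum_univ_two]

theorem conj_first_row_vecMulVec (α β v₁ v₂ : ℂ) :
    !![α, β; 0, 0] * Matrix.vecMulVec ![v₁, v₂] (star ![v₁, v₂]) * !![α, β; 0, 0]ᴴ =
      ((α * v₁ + β * v₂) * star (α * v₁ + β * v₂)) •
        Matrix.vecMulVec ![1, 0] (star ![1, 0]) := by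
  rw [mul_vecMulVec_mul, vecMulVec_one_zero]
  ext i j
  fin_cases i <;> fin_cases j <;> simp [Matrix.vecMulVec_apply]
  ring

theorem normSq_add_ne_zero {α β : ℂ} (h : α ≠ 0 ∨ β ≠ 0) : α * star α + β * star β ≠ 0 := by
  have e : α * star α + β * star β = ((‖α‖ ^ 2 + ‖β‖ ^ 2 : ℝ) : ℂ) := by
    push_cast
    rw [← Complex.mul_conj', ← Complex.mul_conj']
    rfl
  rw [e, Complex.ofReal_ne_zero]
  rcases h with h | h
  · have := norm_pos_iff.2 h
    positivity
  · have := norm_pos_iff.2 h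
    positivity

/-- After division by `l₁ ^ n` the orbit is a function of `(l₂ / l₁) ^ n` alone. That function is
continuous at these points because `g x` is invertible for `x ≠ 0`, so the trace in the denominator
does not vanish. -/
theorem almostPeriodic_orbitState {d : ℕ} {W : Matrix (Fin d) (Fin 2) ℂ} {hW : Wᴴ * W = 1}
    (hl : ‖l₂‖ = ‖l₁‖) (h₁ : l₁ ≠ 0) (hne : l₁ ≠ l₂) (hu : IsUnit !![l₁, b; 0, l₂])
    {σ : Matrix (Fin 2) (Fin 2) ℂ} (hσ : σ.PosSemidef) (h0 : σ ≠ 0) :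
    AlmostPeriodic (orbitState hW hu hσ h0) := by
  apply almostPeriodic_subtype
  have hr : ‖l₂ / l₁‖ = 1 := by rw [norm_div, hl, div_self (norm_ne_zero_iff.2 h₁)]
  let g : ℂ → Matrix (Fin 2) (Fin 2) ℂ := fun x => !![1, b / (l₁ - l₂) * (1 - x); 0, x]
  let Φ : ℂ → Matrix (Fin d) (Fin d) ℂ := fun x =>
    (g x * σ * (g x)ᴴ).trace⁻¹ • (W * (g x * σ * (g x)ᴴ) * Wᴴ)
  have hg : Continuous g := by
    refine continuous_matrix fun i j => ?_
    fin_cases i <;> fin_cases j <;> simp [g] <;> fun_prop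
  have hΦ : ∀ n : ℕ, ContinuousAt Φ ((l₂ / l₁) ^ n) := fun n => by
    have h1 : Continuous fun x => (g x * σ * (g x)ᴴ).trace := by fun_prop
    have h2 : Continuous fun x => W * (g x * σ * (g x)ᴴ) * Wᴴ := by fun_prop
    refine (h1.continuousAt.inv₀ ?_).smul h2.continuousAt
    rw [Ne, (hσ.mul_mul_conjTranspose_same _).trace_eq_zero_iff]
    refine conj_ne_zero ?_ h0
    have hx : (l₂ / l₁) ^ n ≠ 0 := norm_ne_zero_iff.1 (by rw [norm_pow, hr]; simp)
    exact isUnit_triangular one_ne_zero hx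
  have e : (fun n => (orbitState hW hu hσ h0 n).1) = fun n => Φ ((l₂ / l₁) ^ n) := by
    funext n
    have hn : l₁ ^ n ≠ 0 := pow_ne_zero n h₁
    have hA : !![l₁, b; 0, l₂] ^ n = l₁ ^ n • g ((l₂ / l₁) ^ n) :=
      triangular_pow_eq_smul h₁ hne n
    simp only [Φ]
    rw [orbitState, liftState_val, hA, Matrix.conjTranspose_smul, Matrix.smul_mul,
      Matrix.smul_mul, Matrix.mul_smul, smul_smul, Matrix.trace_smul, Matrix.mul_smul,
      Matrix.smul_mul, smul_smul, smul_eq_mul, mul_inv]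
    congr 1
    rw [mul_right_comm, inv_mul_cancel₀ (mul_ne_zero hn (star_ne_zero.2 hn)), one_mul]
  rw [e]
  exact almostPeriodic_of_rotation hr hΦ

end Triangular

/-! ### An orthonormal frame adapted to the measurement and the first eigenvector -/

theorem mulVec_eq_iff_of_isometry {d r : ℕ} {W : Matrix (Fin d) (Fin r) ℂ} (hW : Wᴴ * W = 1)
    {x y : Fin r → ℂ} : W *ᵥ x = W *ᵥ y ↔ x = y := by
  refine ⟨fun h => ?_, fun h => by rw [h]⟩
  rw [← Matrix.one_mulVec x, ← Matrix.one_mulVec y, ← hW, ← Matrix.mulVec_mulVec, h,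
    Matrix.mulVec_mulVec]

theorem PVM.proj_mulVec_of_mem {d k : ℕ} {M : PVM d k} {i : Fin k} {x : Hilb d}
    (hx : x ∈ M.im i) : M.proj i *ᵥ x.ofLp = x.ofLp := by
  obtain ⟨y, rfl⟩ := hx
  rw [Matrix.toLpLin_apply, Matrix.mulVec_mulVec, M.idem]

theorem PVM.proj_eq_vecMulVec {d k : ℕ} {M : PVM d k} {i : Fin k} {z : Hilb d} (hz : ‖z‖ = 1)
    (h : M.im i = Submodule.span ℂ {z}) :
    M.proj i = Matrix.vecMulVec z.ofLp (star z.ofLp) := by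
  have hzz : star z.ofLp ⬝ᵥ z.ofLp = 1 := by
    have := inner_self_eq_norm_sq_to_K (𝕜 := ℂ) z
    rw [EuclideanSpace.inner_eq_star_dotProduct, hz, dotProduct_comm] at this
    simpa using this
  have hmem : z ∈ M.im i := h ▸ Submodule.mem_span_singleton_self z
  have hz' := PVM.proj_mulVec_of_mem hmem
  refine Matrix.ext_of_mulVec_single fun j => ?_
  set x : Fin d → ℂ := Pi.single j 1
  -- The projection sends each vector to a multiple of `z`. Self-adjointness identifies the
  -- coefficient as the inner product with `z`.
  have hx : WithLp.toLp 2 (M.proj i *ᵥ x) ∈ M.im i := ⟨WithLp.toLp 2 x, by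
    rw [Matrix.toLpLin_apply]⟩
  rw [h] at hx
  obtain ⟨c, hc⟩ := Submodule.mem_span_singleton.1 hx
  have hc' : M.proj i *ᵥ x = c • z.ofLp := by
    rw [← WithLp.ofLp_smul, hc]
  have e : star z.ofLp ⬝ᵥ (M.proj i *ᵥ x) = star z.ofLp ⬝ᵥ x := by
    rw [Matrix.dotProduct_mulVec, ← (M.isHermitian i).eq, ← Matrix.star_mulVec, hz']
  rw [Matrix.vecMulVec_mulVec, ← e, hc', dotProduct_smul, hzz]
  ext
  simp [mul_comm]

theorem sum_vecMulVec_orthonormalBasis {d : ℕ} (B : OrthonormalBasis (Fin d) ℂ (Hilb d)) :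
    ∑ j, Matrix.vecMulVec (B j).ofLp (star (B j).ofLp) = 1 := by
  let T : Matrix (Fin d) (Fin d) ℂ := Matrix.of fun i j => (B j).ofLp i
  have h : Tᴴ * T = 1 := by
    ext i j
    have := orthonormal_iff_ite.1 B.orthonormal i j
    rw [EuclideanSpace.inner_eq_star_dotProduct] at this
    rw [Matrix.one_apply, ← this]
    simp [T, Matrix.mul_apply, dotProduct, mul_comm]
  rw [← mul_eq_one_comm.1 h]
  ext i j
  simp [T, Matrix.mul_apply, Matrix.sum_apply, Matrix.vecMulVec_apply]

theorem exists_isometry {M : PVM 3 2} {z : Hilb 3} (hz : ‖z‖ = 1)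
    (hzM : M.im 1 = Submodule.span ℂ {z}) {e : Hilb 3} (he : e ∈ M.im 0) (he0 : e ≠ 0) :
    ∃ W : Matrix (Fin 3) (Fin 2) ℂ, Wᴴ * W = 1 ∧ W * Wᴴ = M.proj 0 ∧
      ∃ c : ℂ, c ≠ 0 ∧ e.ofLp = W *ᵥ ![c, 0] := by
  have hQ := PVM.proj_eq_vecMulVec hz hzM
  have hPQ : M.proj 0 + M.proj 1 = 1 := by rw [← M.sum_proj, Fin.sum_univ_two]
  have hne : (‖e‖ : ℂ) ≠ 0 := by simpa using he0
  have hze : inner ℂ z e = 0 := by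
    have h1 : M.proj 1 *ᵥ e.ofLp = 0 := by
      have h2 : (M.proj 0 + M.proj 1) *ᵥ e.ofLp = e.ofLp := by rw [hPQ, Matrix.one_mulVec]
      rw [Matrix.add_mulVec, PVM.proj_mulVec_of_mem he] at h2
      simpa using h2
    rw [hQ, Matrix.vecMulVec_mulVec] at h1
    rw [EuclideanSpace.inner_eq_star_dotProduct, dotProduct_comm]
    by_contra h0
    have hz0 : z ≠ 0 := by
      rintro rfl
      simp at hz
    apply hz0
    ext i
    have := congrFun h1 i
    simp only [Pi.smul_apply, MulOpposite.smul_eq_mul_unop, MulOpposite.unop_op,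
      Pi.zero_apply] at this
    exact (mul_eq_zero.1 this).resolve_right h0
  let f : Hilb 3 := (‖e‖ : ℂ)⁻¹ • e
  have hf : ‖f‖ = 1 := by
    simp [f, norm_smul, norm_ne_zero_iff.2 he0]
  have hzf : inner ℂ z f = 0 := by rw [inner_smul_right, hze, mul_zero]
  have hfz : inner ℂ f z = 0 := inner_eq_zero_symm.1 hzf
  let v : Fin 3 → Hilb 3 := ![f, 0, z]
  have hv : Orthonormal ℂ (Set.domRestrict {0, 2} v) := by
    rw [orthonormal_iff_ite]
    rintro ⟨i, hi⟩ ⟨j, hj⟩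
    rcases hi with rfl | rfl <;> rcases hj with rfl | rfl <;>
      simp [v, hzf, hfz, hf, hz, inner_self_eq_norm_sq_to_K, Subtype.ext_iff]
  obtain ⟨B, hB⟩ := Orthonormal.exists_orthonormalBasis_extension_of_card_eq (by simp) hv
  have hB0 : B 0 = f := hB 0 (by simp)
  have hB2 : B 2 = z := hB 2 (by simp)
  refine ⟨Matrix.of fun i j => (B (Fin.castSucc j)).ofLp i, ?_, ?_, ‖e‖, hne, ?_⟩
  · ext i j
    have := orthonormal_iff_ite.1 B.orthonormal i.castSucc j.castSucc
    rw [EuclideanSpace.inner_eq_star_dotProduct] at this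
    rw [Matrix.one_apply]
    simp only [Fin.castSucc_inj] at this
    rw [← this]
    simp [Matrix.mul_apply, dotProduct, mul_comm]
  · have hsum := sum_vecMulVec_orthonormalBasis B
    rw [Fin.sum_univ_castSucc, show Fin.last 2 = 2 from rfl, hB2, ← hQ, ← hPQ] at hsum
    rw [← add_right_cancel hsum]
    ext i j
    simp [Matrix.mul_apply, Matrix.sum_apply, Matrix.vecMulVec_apply]
  · ext i
    simp [Matrix.mulVec, dotProduct, Fin.sum_univ_two, hB0, f]
    field_simp

theorem compression_ofLp {d k r : ℕ} {U : Matrix.unitaryGroup (Fin d) ℂ} {M : PVM d k}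
    {i : Fin k} {W : Matrix (Fin d) (Fin r) ℂ} (hP : W * Wᴴ = M.proj i) {x : M.im i}
    {y : Fin r → ℂ} (h : (x : Hilb d).ofLp = W *ᵥ y) :
    (compression U M i x : Hilb d).ofLp = W *ᵥ ((Wᴴ * U.1 * W) *ᵥ y) := by
  have : (compression U M i x : Hilb d) = Matrix.toEuclideanLin (M.proj i)
    (Matrix.toEuclideanLin U.1 (x : Hilb d)) := rfl
  rw [this, Matrix.toLpLin_apply, Matrix.toLpLin_apply, h, ← hP]
  simp only [Matrix.mulVec_mulVec, Matrix.mul_assoc]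

theorem mulVec_of_hasEigenvector {d k r : ℕ} {U : Matrix.unitaryGroup (Fin d) ℂ} {M : PVM d k}
    {i : Fin k} {W : Matrix (Fin d) (Fin r) ℂ} (hW : Wᴴ * W = 1) (hP : W * Wᴴ = M.proj i)
    {l : ℂ} {e : M.im i} (he : Module.End.HasEigenvector (compression U M i) l e)
    {y : Fin r → ℂ} (h : (e : Hilb d).ofLp = W *ᵥ y) : (Wᴴ * U.1 * W) *ᵥ y = l • y := by
  rw [← mulVec_eq_iff_of_isometry hW, ← compression_ofLp hP h, he.apply_eq_smul,
    Matrix.mulVec_smul, ← h]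
  rfl

/-- Carries the relation `(A - l₁) (A - l₂) = 0` to the coordinates of `W`, so that the
characteristic polynomial need not be transported. -/
theorem cayleyHamilton_mulVec {d k r : ℕ} {U : Matrix.unitaryGroup (Fin d) ℂ} {M : PVM d k}
    {i : Fin k} {W : Matrix (Fin d) (Fin r) ℂ} (hW : Wᴴ * W = 1) (hP : W * Wᴴ = M.proj i)
    {l₁ l₂ : ℂ} (hA : (compression U M i).charpoly = (X - C l₁) * (X - C l₂))
    (y : Fin r → ℂ) :
    (Wᴴ * U.1 * W) *ᵥ ((Wᴴ * U.1 * W) *ᵥ y - l₂ • y) =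
      l₁ • ((Wᴴ * U.1 * W) *ᵥ y - l₂ • y) := by
  have hmem : WithLp.toLp 2 (W *ᵥ y) ∈ M.im i := ⟨WithLp.toLp 2 (W *ᵥ y), by
    rw [Matrix.toLpLin_apply, ← hP, ← Matrix.mulVec_mulVec, Matrix.mulVec_mulVec _ Wᴴ, hW,
      Matrix.one_mulVec]⟩
  let x : M.im i := ⟨_, hmem⟩
  have hx : (x : Hilb d).ofLp = W *ᵥ y := rfl
  have hch := LinearMap.aeval_self_charpoly (compression U M i)
  rw [hA] at hch
  have hch' : compression U M i (compression U M i x - l₂ • x) =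
      l₁ • (compression U M i x - l₂ • x) := by
    rw [← sub_eq_zero]
    simpa [Module.End.mul_apply] using LinearMap.congr_fun hch x
  have h1 : ((compression U M i x - l₂ • x : M.im i) : Hilb d).ofLp =
      W *ᵥ ((Wᴴ * U.1 * W) *ᵥ y - l₂ • y) := by
    rw [Matrix.mulVec_sub, Matrix.mulVec_smul, ← compression_ofLp hP hx, ← hx]
    rfl
  rw [← mulVec_eq_iff_of_isometry hW, ← compression_ofLp hP h1, hch', Matrix.mulVec_smul, ← h1]
  rfl

/-- In an orthonormal basis of `im Π_i` starting with an eigenvector, the compression of `U` is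
upper triangular. -/
theorem exists_eq_triangular {d k : ℕ} {U : Matrix.unitaryGroup (Fin d) ℂ} {M : PVM d k}
    {i : Fin k} {W : Matrix (Fin d) (Fin 2) ℂ} (hW : Wᴴ * W = 1) (hP : W * Wᴴ = M.proj i)
    {l₁ l₂ : ℂ} (hA : (compression U M i).charpoly = (X - C l₁) * (X - C l₂)) {e₁ e₂ : M.im i}
    (he₁ : Module.End.HasEigenvector (compression U M i) l₁ e₁)
    (he₂ : Module.End.HasEigenvector (compression U M i) l₂ e₂)
    {c : ℂ} (hc : c ≠ 0) (hce : (e₁ : Hilb d).ofLp = W *ᵥ ![c, 0]) :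
    ∃ b, Wᴴ * U.1 * W = !![l₁, b; 0, l₂] := by
  have h1 := mulVec_of_hasEigenvector hW hP he₁ hce
  have hch := cayleyHamilton_mulVec hW hP hA ![0, 1]
  have he2W : (e₂ : Hilb d).ofLp = W *ᵥ (Wᴴ *ᵥ (e₂ : Hilb d).ofLp) := by
    rw [Matrix.mulVec_mulVec, hP, PVM.proj_mulVec_of_mem e₂.2]
  have h2 := mulVec_of_hasEigenvector hW hP he₂ he2W
  have hy : Wᴴ *ᵥ (e₂ : Hilb d).ofLp ≠ 0 := by
    intro h
    rw [h, Matrix.mulVec_zero] at he2W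
    exact he₂.2 (Subtype.ext (WithLp.ofLp_injective 2 he2W))
  generalize Wᴴ *ᵥ (e₂ : Hilb d).ofLp = y at h2 hy
  generalize Wᴴ * U.1 * W = A at *
  have h00 := congrFun h1 0
  have h10 := congrFun h1 1
  have hch0 := congrFun hch 0
  have hch1 := congrFun hch 1
  have hy0 := congrFun h2 0
  have hy1 := congrFun h2 1
  simp [Matrix.mulVec, dotProduct, Fin.sum_univ_two, hc] at h00 h10 hch0 hch1 hy0 hy1
  rw [h00] at hch0 hy0
  rw [h10] at hch1 hy1
  -- If the corner were not `l₂`, Cayley–Hamilton on the second basis vector would make it `l₁` and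
  -- `A 0 1 = 0`. Then `A` would be the scalar `l₁ ≠ l₂`, leaving no room for the eigenvector `e₂`.
  have h11 : A 1 1 = l₂ := by
    by_contra hne
    have hne' : A 1 1 - l₂ ≠ 0 := sub_ne_zero.2 hne
    have ha : A 1 1 = l₁ := by
      apply mul_right_cancel₀ hne'
      linear_combination hch1
    have hb : A 0 1 = 0 := by
      have : A 0 1 * (A 1 1 - l₂) = 0 := by linear_combination hch0
      exact (mul_eq_zero.1 this).resolve_right hne'
    rw [ha] at hne' hy1
    rw [hb] at hy0
    apply hy
    ext j
    fin_cases j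
    · have : (l₁ - l₂) * y 0 = 0 := by linear_combination hy0
      simpa [hne'] using this
    · have : (l₁ - l₂) * y 1 = 0 := by linear_combination hy1
      simpa [hne'] using this
  refine ⟨A 0 1, ?_⟩
  ext i j
  fin_cases i <;> fin_cases j <;> simp [h00, h10, h11]

/-- Insert `W W* + z z* = 1` between `V` and `V*` in `W* V V* W = 1`. Taking `V = U` gives the row
relations of the bordered matrix, `V = U*` the column relations. -/
theorem compression_mul_conjTranspose {V : Matrix (Fin 3) (Fin 3) ℂ} (hV : V * Vᴴ = 1)
    {W : Matrix (Fin 3) (Fin 2) ℂ} (hW : Wᴴ * W = 1) {z : Fin 3 → ℂ}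
    (h : W * Wᴴ + Matrix.vecMulVec z (star z) = 1) :
    (Wᴴ * V * W) * (Wᴴ * V * W)ᴴ +
      Matrix.vecMulVec (Wᴴ *ᵥ (V *ᵥ z)) (star (Wᴴ *ᵥ (V *ᵥ z))) = 1 := by
  rw [Matrix.mulVec_mulVec, ← mul_vecMulVec_mul, eq_sub_iff_add_eq'.2 h]
  have e : (Wᴴ * V * W) * (Wᴴ * V * W)ᴴ = (Wᴴ * V) * (W * Wᴴ) * (Wᴴ * V)ᴴ := by
    simp only [Matrix.conjTranspose_mul, Matrix.mul_assoc]
  rw [e, ← Matrix.add_mul, ← Matrix.mul_add, add_sub_cancel, Matrix.mul_one,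
    Matrix.conjTranspose_mul, Matrix.conjTranspose_conjTranspose, Matrix.mul_assoc,
    ← Matrix.mul_assoc V, hV, Matrix.one_mul, hW]

/-- The relations between the entries of a unitary `3 × 3` matrix
`!![l₁, b, v₁; 0, l₂, v₂; u₁, u₂, ω]` up to conjugation of the last row. -/
structure UnitaryEntries (l₁ l₂ b v₁ v₂ u₁ u₂ ω : ℂ) : Prop where
  row_one : ‖l₁‖ ^ 2 + ‖b‖ ^ 2 + ‖v₁‖ ^ 2 = 1
  row_two : ‖l₂‖ ^ 2 + ‖v₂‖ ^ 2 = 1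
  row_one_two : b * star l₂ + v₁ * star v₂ = 0
  col_one : ‖l₁‖ ^ 2 + ‖u₁‖ ^ 2 = 1
  col_two : ‖b‖ ^ 2 + ‖l₂‖ ^ 2 + ‖u₂‖ ^ 2 = 1
  col_one_two : star l₁ * b + u₁ * star u₂ = 0
  col_three : ‖v₁‖ ^ 2 + ‖v₂‖ ^ 2 + ‖ω‖ ^ 2 = 1

theorem conjTranspose_triangular (l₁ l₂ b : ℂ) :
    (!![l₁, b; 0, l₂])ᴴ = !![star l₁, 0; star b, star l₂] := by
  ext i j
  fin_cases i <;> fin_cases j <;> simp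

theorem unitaryEntries {U : Matrix.unitaryGroup (Fin 3) ℂ} {W : Matrix (Fin 3) (Fin 2) ℂ}
    (hW : Wᴴ * W = 1) {z : Hilb 3} (hz : ‖z‖ = 1)
    (h : W * Wᴴ + Matrix.vecMulVec z.ofLp (star z.ofLp) = 1) {l₁ l₂ b : ℂ}
    (hA : Wᴴ * U.1 * W = !![l₁, b; 0, l₂]) :
    ∃ v₁ v₂ u₁ u₂, Wᴴ *ᵥ (U.1 *ᵥ z.ofLp) = ![v₁, v₂] ∧
      UnitaryEntries l₁ l₂ b v₁ v₂ u₁ u₂ (inner ℂ z (Matrix.toEuclideanLin U.1 z)) := by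
  have hUU : U.1 * U.1ᴴ = 1 := Matrix.mem_unitaryGroup_iff.1 U.2
  have hUU' : U.1ᴴ * U.1 = 1 := Matrix.mem_unitaryGroup_iff'.1 U.2
  have hrow := compression_mul_conjTranspose hUU hW h
  have hcol := compression_mul_conjTranspose (V := U.1ᴴ) (by simpa using hUU') hW h
  have hA' : Wᴴ * U.1ᴴ * W = (!![l₁, b; 0, l₂])ᴴ := by
    rw [← hA]
    simp only [Matrix.conjTranspose_mul, Matrix.conjTranspose_conjTranspose, Matrix.mul_assoc]
  have hthree : star (Wᴴ *ᵥ (U.1 *ᵥ z.ofLp)) ⬝ᵥ (Wᴴ *ᵥ (U.1 *ᵥ z.ofLp)) +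
      inner ℂ z (Matrix.toEuclideanLin U.1 z) *
        star (inner ℂ z (Matrix.toEuclideanLin U.1 z)) = 1 := by
    have hzz : star z.ofLp ⬝ᵥ z.ofLp = 1 := by
      have := inner_self_eq_norm_sq_to_K (𝕜 := ℂ) z
      rw [EuclideanSpace.inner_eq_star_dotProduct, hz, dotProduct_comm] at this
      simpa using this
    have h1 : star (U.1 *ᵥ z.ofLp) ⬝ᵥ (U.1 *ᵥ z.ofLp) = 1 := by
      rw [Matrix.star_mulVec, ← Matrix.dotProduct_mulVec, Matrix.mulVec_mulVec, hUU',
        Matrix.one_mulVec, hzz]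
    have h2 : star (U.1 *ᵥ z.ofLp) ⬝ᵥ
        ((W * Wᴴ + Matrix.vecMulVec z.ofLp (star z.ofLp)) *ᵥ (U.1 *ᵥ z.ofLp)) = 1 := by
      rw [h, Matrix.one_mulVec, h1]
    rw [← h2, Matrix.add_mulVec, dotProduct_add, EuclideanSpace.inner_eq_star_dotProduct,
      Matrix.toLpLin_apply, Matrix.vecMulVec_mulVec, ← Matrix.mulVec_mulVec,
      Matrix.dotProduct_mulVec _ W, Matrix.star_mulVec Wᴴ, Matrix.conjTranspose_conjTranspose,
      dotProduct_smul]
    have hstar : star (star z.ofLp ⬝ᵥ (U.1 *ᵥ z.ofLp)) = star (U.1 *ᵥ z.ofLp) ⬝ᵥ z.ofLp := by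
      rw [Matrix.star_dotProduct, star_star, Matrix.star_dotProduct]
    rw [dotProduct_comm (WithLp.toLp 2 (U.1 *ᵥ z.ofLp)).ofLp, ← hstar]
    simp [mul_comm]
  rw [hA] at hrow
  rw [hA', Matrix.conjTranspose_conjTranspose] at hcol
  rw [conjTranspose_triangular] at hrow hcol
  generalize Wᴴ *ᵥ (U.1 *ᵥ z.ofLp) = v at hrow hthree ⊢
  generalize Wᴴ *ᵥ (U.1ᴴ *ᵥ z.ofLp) = u at hcol
  generalize inner ℂ z (Matrix.toEuclideanLin U.1 z) = ω at hthree ⊢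
  refine ⟨v 0, v 1, u 0, u 1, by ext i; fin_cases i <;> rfl, ?_⟩
  have r00 := congrFun (congrFun hrow 0) 0
  have r01 := congrFun (congrFun hrow 0) 1
  have r11 := congrFun (congrFun hrow 1) 1
  have c00 := congrFun (congrFun hcol 0) 0
  have c01 := congrFun (congrFun hcol 0) 1
  have c11 := congrFun (congrFun hcol 1) 1
  simp [Fin.sum_univ_two, Matrix.vecMulVec_apply, Complex.mul_conj',
    Complex.conj_mul', dotProduct] at r00 r01 r11 c00 c01 c11 hthree
  constructor
  · exact_mod_cast r00
  · exact_mod_cast r11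
  · exact r01
  · exact_mod_cast c00
  · exact_mod_cast c11
  · exact c01
  · exact_mod_cast hthree

namespace UnitaryEntries

variable {l₁ l₂ b v₁ v₂ u₁ u₂ ω : ℂ}

theorem norm_le_one (h : UnitaryEntries l₁ l₂ b v₁ v₂ u₁ u₂ ω) : ‖l₁‖ ≤ 1 := by
  nlinarith [h.col_one, sq_nonneg ‖u₁‖, norm_nonneg l₁]

theorem b_eq_zero (h : UnitaryEntries l₁ l₂ b v₁ v₂ u₁ u₂ ω) (h₁ : ‖l₁‖ = 1) : b = 0 := by
  have := h.row_one
  rw [h₁] at this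
  have hb : ‖b‖ ^ 2 = 0 := by nlinarith [sq_nonneg ‖b‖, sq_nonneg ‖v₁‖]
  simpa using hb

theorem v₁_eq_zero (h : UnitaryEntries l₁ l₂ b v₁ v₂ u₁ u₂ ω) (h₁ : ‖l₁‖ = 1) : v₁ = 0 := by
  have := h.row_one
  rw [h₁] at this
  have hb : ‖v₁‖ ^ 2 = 0 := by nlinarith [sq_nonneg ‖b‖, sq_nonneg ‖v₁‖]
  simpa using hb

theorem v₂_ne_zero (h : UnitaryEntries l₁ l₂ b v₁ v₂ u₁ u₂ ω) (h₂ : ‖l₂‖ < 1) : v₂ ≠ 0 := by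
  rintro rfl
  have := h.row_two
  rw [norm_zero] at this
  nlinarith [norm_nonneg l₂]

/-- If `b = 0`, orthogonality of the first two columns gives `u₁ = 0` or `u₂ = 0`, and the
corresponding unit column then forces `‖l₁‖ = 1` or `‖l₂‖ = 1`. -/
theorem b_ne_zero (h : UnitaryEntries l₁ l₂ b v₁ v₂ u₁ u₂ ω) (hle : ‖l₂‖ ≤ ‖l₁‖)
    (h₁ : ‖l₁‖ < 1) : b ≠ 0 := by
  rintro rfl
  have hu := h.col_one_two
  rw [mul_zero, zero_add, mul_eq_zero, star_eq_zero] at hu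
  rcases hu with rfl | rfl
  · have := h.col_one
    rw [norm_zero] at this
    nlinarith [norm_nonneg l₁]
  · have := h.col_two
    rw [norm_zero] at this
    nlinarith [norm_nonneg l₂]

/-- If the expression vanished, the row relations would give `b * l₁ * star l₂ = b`, hence `‖l₁‖ *
‖l₂‖ = 1`. -/
theorem not_eigenvector (h : UnitaryEntries l₁ l₂ b v₁ v₂ u₁ u₂ ω) (hle : ‖l₂‖ ≤ ‖l₁‖)
    (h₁ : ‖l₁‖ < 1) : (l₁ - l₂) * v₁ + b * v₂ ≠ 0 := by
  intro h0
  have hb := h.b_ne_zero hle h₁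
  have hrow : l₂ * star l₂ + v₂ * star v₂ = 1 := by
    have := h.row_two
    rw [← Complex.ofReal_inj] at this
    push_cast at this
    rwa [← Complex.mul_conj', ← Complex.mul_conj'] at this
  have e : b * (l₁ * star l₂) = b * 1 := by
    linear_combination (l₁ - l₂) * h.row_one_two - star v₂ * h0 + b * hrow
  have e' := congrArg norm (mul_left_cancel₀ hb e)
  rw [norm_mul, norm_star, norm_one] at e'
  nlinarith [norm_nonneg l₁, norm_nonneg l₂]

theorem norm_sq_v (h : UnitaryEntries l₁ l₂ b v₁ v₂ u₁ u₂ ω) :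
    ‖v₁‖ ^ 2 + ‖v₂‖ ^ 2 = 1 - ‖ω‖ ^ 2 := by
  linarith [h.col_three]

theorem omega_eq_zero (h : UnitaryEntries l₁ l₂ b v₁ v₂ u₁ u₂ ω) (h₂ : l₂ = 0) : ω = 0 := by
  have h3 := h.row_two
  have hc := h.col_three
  rw [h₂, norm_zero] at h3
  have : ‖ω‖ ^ 2 = 0 := by nlinarith [sq_nonneg ‖ω‖, sq_nonneg ‖v₁‖]
  simpa using this

end UnitaryEntries

/-! ### The structure of the chain -/

namespace PIFS

variable {k : ℕ} {X : Type*} {P : PIFS k X}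

theorem Maps.unique {i : Fin k} {x y y' : X} (h : P.Maps i x y) (h' : P.Maps i x y') : y = y' := by
  obtain ⟨_, rfl⟩ := h
  obtain ⟨_, rfl⟩ := h'
  rfl

theorem Maps.pos {i : Fin k} {x y : X} (h : P.Maps i x y) : 0 < P.p i x := h.1

theorem evolves_append_singleton {ι : List (Fin k)} {i : Fin k} {x y : X} :
    P.Evolves (ι ++ [i]) x y ↔ ∃ x', P.Evolves ι x x' ∧ P.Maps i x' y := by
  induction ι generalizing x with
  | nil =>
    simp only [List.nil_append, Evolves]
    exact ⟨fun ⟨x', h, e⟩ => ⟨x, rfl, e ▸ h⟩, fun ⟨x', e, h⟩ => ⟨y, e ▸ h, rfl⟩⟩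
  | cons j ι ih =>
    simp only [List.cons_append, Evolves, ih]
    exact ⟨fun ⟨x', h, x'', h', h''⟩ => ⟨x'', ⟨x', h, h'⟩, h''⟩,
      fun ⟨x'', ⟨x', h, h'⟩, h''⟩ => ⟨x', h, x'', h', h''⟩⟩

/-- If outcome `1` always leads to `z`, then the states reached from `x₀` are those on the
trajectories of `z` and of the image `m` of `x₀` under `F 0`. -/
theorem stateSpace_eq_of_maps_one {P : PIFS 2 X} {x₀ z m : X}
    (hone : ∀ x y, P.Maps 1 x y → y = z) (hz : P.Maps 1 x₀ z) (hm : P.Maps 0 x₀ m) :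
    P.stateSpace x₀ = {y | ∃ n, P.Evolves (List.replicate n 0) z y ∨
      P.Evolves (List.replicate n 0) m y} := by
  ext y
  constructor
  · rintro ⟨ι, hι, h⟩
    -- The union of the two trajectories is invariant: outcome `0` moves one step along a trajectory
    -- and outcome `1` restarts at `z`.
    have step : ∀ (ι : List (Fin 2)) (x : X),
        (∃ n, P.Evolves (List.replicate n 0) z x ∨ P.Evolves (List.replicate n 0) m x) →
        P.Evolves ι x y →
        ∃ n, P.Evolves (List.replicate n 0) z y ∨ P.Evolves (List.replicate n 0) m y := by
      intro ι
      induction ι with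
      | nil => exact fun x hx e => e ▸ hx
      | cons i ι ih =>
        rintro x ⟨n, hn⟩ ⟨x', hx', h⟩
        refine ih x' ?_ h
        rcases Fin.exists_fin_two.1 ⟨i, rfl⟩ with rfl | rfl
        · refine ⟨n + 1, ?_⟩
          rw [List.replicate_succ']
          exact hn.imp (fun h => evolves_append_singleton.2 ⟨x, h, hx'⟩)
            (fun h => evolves_append_singleton.2 ⟨x, h, hx'⟩)
        · exact ⟨0, Or.inl (hone _ _ hx').symm⟩
    cases ι with
    | nil => exact absurd rfl hι
    | cons i ι =>
      obtain ⟨x', hx', h⟩ := h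
      refine step ι x' ⟨0, ?_⟩ h
      rcases Fin.exists_fin_two.1 ⟨i, rfl⟩ with rfl | rfl
      · exact Or.inr (hm.unique hx')
      · exact Or.inl (hone _ _ hx').symm
  · rintro ⟨n, h | h⟩
    · exact ⟨1 :: List.replicate n 0, by simp, z, hz, h⟩
    · exact ⟨0 :: List.replicate n 0, by simp, m, hm, h⟩

end PIFS

/-! ### Transition probabilities with a rank one reset outcome -/

section Chain

variable {d k : ℕ} {U : Matrix.unitaryGroup (Fin d) ℂ} {M : PVM d k}

theorem PVM.proj_one_mul_proj_zero {M : PVM d 2} : M.proj 1 * M.proj 0 = 0 := by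
  have h : M.proj 0 = 1 - M.proj 1 := by
    rw [← M.sum_proj, Fin.sum_univ_two, add_sub_cancel_right]
  rw [h, mul_sub, mul_one, M.idem, sub_self]

theorem unnorm_ne_zero_of_pos {i : Fin k} {ρ : State d} (h : 0 < (pifs U M).p i ρ) :
    unnorm U M i ρ ≠ 0 := by
  intro h0
  change 0 < born U M i ρ at h
  rw [born, ← unnorm_trace, h0] at h
  simp at h

theorem pureState_val {z : Hilb d} (hz : ‖z‖ = 1) (hz0 : z ≠ 0) :
    (pureState z hz0).1 = Matrix.vecMulVec z.ofLp (star z.ofLp) := by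
  have hzz : z.ofLp ⬝ᵥ star z.ofLp = 1 := by
    have := inner_self_eq_norm_sq_to_K (𝕜 := ℂ) z
    rw [EuclideanSpace.inner_eq_star_dotProduct, hz] at this
    simpa using this
  rw [pureState, normState_val, Matrix.trace_vecMulVec, hzz, inv_one, one_smul]

/-- Compressing any matrix by `z z*` leaves a multiple of `z z*`. -/
theorem maps_pureState_of_pos {i : Fin k} {z : Hilb d} (hz0 : z ≠ 0)
    (hQ : M.proj i = Matrix.vecMulVec z.ofLp (star z.ofLp)) {ρ : State d}
    (h : 0 < (pifs U M).p i ρ) : (pifs U M).Maps i ρ (pureState z hz0) := by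
  have e : unnorm U M i ρ = (star z.ofLp ⬝ᵥ ((U.1 * ρ.1 * U.1ᴴ) *ᵥ z.ofLp)) •
      Matrix.vecMulVec z.ofLp (star z.ofLp) := by
    rw [unnorm, hQ, Matrix.vecMulVec_mul, Matrix.vecMulVec_mul_vecMulVec,
      ← Matrix.dotProduct_mulVec]
    ext i j
    simp only [Matrix.vecMulVec_apply, Matrix.smul_apply, Pi.smul_apply, smul_eq_mul]
    ring
  refine maps_normState _ _ ?_ e
  intro h0
  rw [h0, zero_smul] at e
  exact unnorm_ne_zero_of_pos h e

variable {U : Matrix.unitaryGroup (Fin d) ℂ} {M : PVM d 2} {z : Hilb d} {hz0 : z ≠ 0}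

theorem eq_pureState_of_maps_one (hQ : M.proj 1 = Matrix.vecMulVec z.ofLp (star z.ofLp))
    {ρ ρ' : State d} (h : (pifs U M).Maps 1 ρ ρ') : ρ' = pureState z hz0 :=
  h.unique (maps_pureState_of_pos hz0 hQ h.pos)

/-- Outputs of outcome `0` are annihilated by `M.proj 1`. The two outcomes thus never share a
target, and every transition probability is a single Born probability or zero. -/
theorem ne_pureState_of_maps_zero (hz : ‖z‖ = 1)
    (hQ : M.proj 1 = Matrix.vecMulVec z.ofLp (star z.ofLp))
    {ρ ρ' : State d} (h : (pifs U M).Maps 0 ρ ρ') : ρ' ≠ pureState z hz0 := by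
  obtain ⟨h, rfl⟩ := h
  intro e
  have e' := congrArg (fun σ : State d => M.proj 1 * σ.1) e
  rw [pureState_val hz, ← hQ, M.idem] at e'
  apply M.ne_zero 1
  rw [← e']
  change M.proj 1 * (_ • (M.proj 0 * _ * M.proj 0)) = 0
  rw [Matrix.mul_smul, Matrix.mul_assoc, ← Matrix.mul_assoc, PVM.proj_one_mul_proj_zero,
    Matrix.zero_mul, smul_zero]

theorem trans_pureState (hz : ‖z‖ = 1)
    (hQ : M.proj 1 = Matrix.vecMulVec z.ofLp (star z.ofLp)) (ρ : State d) :
    (pifs U M).trans ρ (pureState z hz0) = (pifs U M).p 1 ρ := by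
  rw [PIFS.trans, Fin.sum_univ_two, if_neg fun h => ne_pureState_of_maps_zero hz hQ h rfl, zero_add]
  split_ifs with h
  · rfl
  · refine le_antisymm ((pifs U M).p_nonneg 1 ρ) (not_lt.1 fun h0 => ?_)
    exact h (maps_pureState_of_pos hz0 hQ h0)

theorem trans_of_maps_zero (hz : ‖z‖ = 1) (hz0 : z ≠ 0)
    (hQ : M.proj 1 = Matrix.vecMulVec z.ofLp (star z.ofLp)) {ρ ρ' : State d}
    (h : (pifs U M).Maps 0 ρ ρ') : (pifs U M).trans ρ ρ' = (pifs U M).p 0 ρ := by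
  rw [PIFS.trans, Fin.sum_univ_two, if_pos h, if_neg, add_zero]
  exact fun h1 => ne_pureState_of_maps_zero (hz0 := hz0) hz hQ h (eq_pureState_of_maps_one hQ h1)

theorem trans_eq_zero (hQ : M.proj 1 = Matrix.vecMulVec z.ofLp (star z.ofLp)) {ρ ρ' : State d}
    (hne : ρ' ≠ pureState z hz0) (h : ¬ (pifs U M).Maps 0 ρ ρ') :
    (pifs U M).trans ρ ρ' = 0 := by
  rw [PIFS.trans, Fin.sum_univ_two, if_neg h, if_neg, add_zero]
  exact fun h1 => hne (eq_pureState_of_maps_one hQ h1)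

theorem unnorm_maxMixed [NeZero d] {k : ℕ} {M : PVM d k} (i : Fin k) :
    unnorm U M i (maxMixed d) = (d : ℂ)⁻¹ • M.proj i := by
  have hUU : U.1 * U.1ᴴ = 1 := Matrix.mem_unitaryGroup_iff.1 U.2
  rw [unnorm, maxMixed, normState_val, Matrix.trace_one, Fintype.card_fin, Matrix.mul_smul,
    Matrix.smul_mul, Matrix.mul_smul, Matrix.smul_mul, Matrix.mul_one, hUU, Matrix.mul_one, M.idem]

theorem maps_maxMixed [NeZero d] {k : ℕ} {M : PVM d k} (i : Fin k) :
    (pifs U M).Maps i (maxMixed d) (M.maxMixedOn i) :=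
  maps_normState _ _ (inv_ne_zero (NeZero.ne _)) (unnorm_maxMixed i)

theorem maxMixedOn_eq_liftState {k r : ℕ} [NeZero r] {M : PVM d k} {i : Fin k}
    {W : Matrix (Fin d) (Fin r) ℂ} {hW : Wᴴ * W = 1} (hP : W * Wᴴ = M.proj i) :
    M.maxMixedOn i = liftState hW 1 Matrix.PosSemidef.one one_ne_zero :=
  normState_eq_iff.2 ⟨1, by rw [Matrix.mul_one, hP, one_smul]⟩

theorem born_maxMixed [NeZero d] {k r : ℕ} {M : PVM d k} {i : Fin k}
    {W : Matrix (Fin d) (Fin r) ℂ} (hW : Wᴴ * W = 1) (hP : W * Wᴴ = M.proj i) :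
    (pifs U M).p i (maxMixed d) = r / d := by
  change born U M i _ = _
  rw [born, ← unnorm_trace, unnorm_maxMixed, Matrix.trace_smul, ← hP, Matrix.trace_mul_comm, hW,
    Matrix.trace_one, Fintype.card_fin, smul_eq_mul, ← Complex.ofReal_natCast d,
    ← Complex.ofReal_natCast r, ← Complex.ofReal_inv, ← Complex.ofReal_mul, Complex.ofReal_re,
    div_eq_inv_mul]

theorem unnorm_pureState {k : ℕ} {M : PVM d k} (i : Fin k) (hz : ‖z‖ = 1) :
    unnorm U M i (pureState z hz0) =
      Matrix.vecMulVec (M.proj i *ᵥ (U.1 *ᵥ z.ofLp)) (star (M.proj i *ᵥ (U.1 *ᵥ z.ofLp))) := by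
  rw [unnorm, pureState_val hz, mul_vecMulVec_mul]
  nth_rewrite 2 [← (M.isHermitian i).eq]
  rw [mul_vecMulVec_mul]

theorem born_liftState_of_conj {k r : ℕ} {M : PVM d k} {i : Fin k}
    {W : Matrix (Fin d) (Fin r) ℂ} {hW : Wᴴ * W = 1} {A : Matrix (Fin r) (Fin r) ℂ}
    (hP : W * Wᴴ = M.proj i) (hA : A = Wᴴ * U.1 * W) {σ : Matrix (Fin r) (Fin r) ℂ}
    (hσ : σ.PosSemidef) (h0 : σ ≠ 0) {c : ℂ} (h : A * σ * Aᴴ = c • σ) :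
    (pifs U M).p i (liftState hW σ hσ h0) = c.re := by
  have htr : σ.trace ≠ 0 := fun h => h0 (hσ.trace_eq_zero_iff.1 h)
  rw [born_liftState hP hA, h, Matrix.trace_smul, smul_eq_mul, mul_left_comm,
    inv_mul_cancel₀ htr, mul_one]

end Chain

/-! ### The angle and the classification -/

theorem exp_angle {l₁ l₂ : ℂ} (hl : ‖l₂‖ = ‖l₁‖) (h₁ : l₁ ≠ 0) :
    Complex.exp (angle l₁ l₂ * Complex.I) = l₂ / l₁ := by
  have h := Complex.norm_mul_exp_arg_mul_I (l₂ / l₁)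
  rwa [norm_div, hl, div_self (norm_ne_zero_iff.2 h₁), Complex.ofReal_one, one_mul] at h

theorem angle_eq_zero_iff {l₁ l₂ : ℂ} (hl : ‖l₂‖ = ‖l₁‖) (h₁ : l₁ ≠ 0) :
    angle l₁ l₂ = 0 ↔ l₁ = l₂ := by
  constructor
  · intro h
    have := exp_angle hl h₁
    rw [h, Complex.ofReal_zero, zero_mul, Complex.exp_zero, eq_comm, div_eq_one_iff_eq h₁] at this
    exact this.symm
  · rintro rfl
    rw [angle, div_self h₁, Complex.arg_one]

theorem div_pow_eq_one_iff {l₁ l₂ : ℂ} (h₁ : l₁ ≠ 0) (k : ℕ) :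
    (l₂ / l₁) ^ k = 1 ↔ l₁ ^ k = l₂ ^ k := by
  rw [div_pow, div_eq_one_iff_eq (pow_ne_zero k h₁), eq_comm]

theorem commensurable_of_pow_eq {l₁ l₂ : ℂ} (hl : ‖l₂‖ = ‖l₁‖) (h₁ : l₁ ≠ 0) {k : ℕ}
    (hk : 0 < k) (h : l₁ ^ k = l₂ ^ k) : Commensurable (angle l₁ l₂) := by
  rw [← div_pow_eq_one_iff h₁, ← exp_angle hl h₁, ← Complex.exp_nat_mul,
    Complex.exp_eq_one_iff] at h
  obtain ⟨n, hn⟩ := h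
  refine ⟨2 * n / k, ?_⟩
  have e : ((k * angle l₁ l₂ : ℝ) : ℂ) = ((n * (2 * Real.pi) : ℝ) : ℂ) := by
    apply mul_right_cancel₀ Complex.I_ne_zero
    push_cast
    linear_combination hn
  have e' := Complex.ofReal_injective e
  have hk' : (k : ℝ) ≠ 0 := Nat.cast_ne_zero.2 hk.ne'
  push_cast
  field_simp
  linear_combination e'

theorem exists_isPrimitiveRoot {l₁ l₂ : ℂ} (hl : ‖l₂‖ = ‖l₁‖) (h₁ : l₁ ≠ 0)
    (h : Commensurable (angle l₁ l₂)) : ∃ κ, 0 < κ ∧ IsPrimitiveRoot (l₂ / l₁) κ := by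
  obtain ⟨q, hq⟩ := h
  refine ⟨orderOf (l₂ / l₁), ?_, IsPrimitiveRoot.orderOf _⟩
  -- If `ψ = π * q`, then `2 * q.den * ψ` is the multiple `q.num` of `2π`.
  refine orderOf_pos_iff.2 (isOfFinOrder_iff_pow_eq_one.2 ⟨2 * q.den, by have := q.pos; omega, ?_⟩)
  rw [← exp_angle hl h₁, ← Complex.exp_nat_mul, Complex.exp_eq_one_iff]
  refine ⟨q.num, ?_⟩
  have hd : ((q.den : ℝ) : ℂ) * ((q : ℝ) : ℂ) = ((q.num : ℝ) : ℂ) := by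
    rw [← Complex.ofReal_mul]
    exact_mod_cast congrArg (fun x : ℚ => ((x : ℝ) : ℂ)) (Rat.den_mul_eq_num q)
  rw [hq]
  push_cast at hd ⊢
  linear_combination (2 * (Real.pi : ℂ) * Complex.I) * hd

theorem existsUnique_chainType {l₁ l₂ : ℂ} (hle : ‖l₂‖ ≤ ‖l₁‖) (h1 : ‖l₁‖ ≤ 1) :
    ∃! τ : ChainType, τ.Cond l₁ l₂ := by
  by_cases h₂ : l₂ = 0
  · subst h₂
    by_cases h₁ : l₁ = 0
    · refine ⟨.doubleNull, ⟨rfl, h₁⟩, fun τ h => ?_⟩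
      cases τ <;> simp_all [ChainType.Cond]
    · have hpos := norm_pos_iff.2 h₁
      rcases h1.lt_or_eq with h | h
      · refine ⟨.genericNull, ⟨rfl, hpos, h⟩, fun τ h => ?_⟩
        cases τ <;> simp_all [ChainType.Cond]
      · refine ⟨.taupekNull, ⟨rfl, h⟩, fun τ h => ?_⟩
        cases τ <;> simp_all [ChainType.Cond]
  · have hpos := norm_pos_iff.2 h₂
    have h₁ : l₁ ≠ 0 := norm_pos_iff.1 (hpos.trans_le hle)
    rcases hle.lt_or_eq with hlt | hl
    · have hne : l₁ ≠ l₂ := by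
        rintro rfl
        exact lt_irrefl _ hlt
      rcases h1.lt_or_eq with h | h
      · refine ⟨.generic, Or.inl ⟨hpos, hlt, h⟩, fun τ hτ => ?_⟩
        cases τ <;> simp_all [ChainType.Cond]
      · refine ⟨.taupek, ⟨hpos, hlt, h⟩, fun τ hτ => ?_⟩
        cases τ <;> simp_all [ChainType.Cond]
    · have hz := angle_eq_zero_iff hl h₁
      rcases h1.lt_or_eq with h | h
      · by_cases he : l₁ = l₂
        · have hc : Commensurable (angle l₁ l₂) := ⟨0, by simp [hz.2 he]⟩
          refine ⟨.generic, Or.inr ⟨he, norm_pos_iff.2 h₁, h⟩, fun τ hτ => ?_⟩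
          cases τ <;> simp_all [ChainType.Cond]
        · by_cases hc : Commensurable (angle l₁ l₂)
          · refine ⟨.finElliptic, ⟨hpos, hl, h, hc, fun h => he (hz.1 h)⟩, fun τ hτ => ?_⟩
            cases τ <;> simp_all [ChainType.Cond]
          · refine ⟨.infElliptic, ⟨hpos, hl, h, hc⟩, fun τ hτ => ?_⟩
            cases τ <;> simp_all [ChainType.Cond]
      · refine ⟨.unitary, ⟨hl, h⟩, fun τ hτ => ?_⟩
        cases τ <;> simp_all [ChainType.Cond]

/-! ### Pure states lifted along an isometry -/

section Line

variable {d r k : ℕ} {W : Matrix (Fin d) (Fin r) ℂ} {M : PVM d k} {i : Fin k}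
  {U : Matrix.unitaryGroup (Fin d) ℂ} {A : Matrix (Fin r) (Fin r) ℂ}

/-- The pure state of the vector `W x`. -/
def lineState (hW : Wᴴ * W = 1) (x : Fin r → ℂ) (hx : x ≠ 0) : State d :=
  liftState hW (Matrix.vecMulVec x (star x)) (Matrix.posSemidef_vecMulVec_self_star x)
    (vecMulVec_star_ne_zero hx)

theorem vecMulVec_smul_star {n : ℕ} (c : ℂ) (x : Fin n → ℂ) :
    Matrix.vecMulVec (c • x) (star (c • x)) = (c * star c) • Matrix.vecMulVec x (star x) := by
  ext i j
  simp [Matrix.vecMulVec_apply]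
  ring

variable {hW : Wᴴ * W = 1}

theorem lineState_eq_of_smul {c : ℂ} {x y : Fin r → ℂ} {hx : x ≠ 0} {hy : y ≠ 0}
    (h : x = c • y) : lineState hW x hx = lineState hW y hy :=
  liftState_eq_iff.2 ⟨c * star c, by rw [h, vecMulVec_smul_star]⟩

theorem maps_lineState (hP : W * Wᴴ = M.proj i) (hA : A = Wᴴ * U.1 * W) {x y : Fin r → ℂ}
    (hx : x ≠ 0) (hy : y ≠ 0) {c : ℂ} (hc : c ≠ 0) (h : A *ᵥ x = c • y) :
    (pifs U M).Maps i (lineState hW x hx) (lineState hW y hy) :=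
  maps_liftState hP hA _ _ _ _ (mul_ne_zero hc (star_ne_zero.2 hc))
    (by rw [mul_vecMulVec_mul, h, vecMulVec_smul_star])

theorem born_lineState (hP : W * Wᴴ = M.proj i) (hA : A = Wᴴ * U.1 * W) {x : Fin r → ℂ}
    (hx : x ≠ 0) {c : ℂ} (h : A *ᵥ x = c • x) :
    (pifs U M).p i (lineState hW x hx) = ‖c‖ ^ 2 := by
  rw [lineState, born_liftState_of_conj hP hA _ _ (c := c * star c)
    (by rw [mul_vecMulVec_mul, h, vecMulVec_smul_star])]
  have : c * star c = ((‖c‖ ^ 2 : ℝ) : ℂ) := by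
    rw [Complex.star_def, Complex.mul_conj']
    push_cast
    rfl
  rw [this, Complex.ofReal_re]

theorem eigenState_eq_lineState {l : ℂ} {e : M.im i}
    (he : Module.End.HasEigenvector (compression U M i) l e) {c : ℂ} {x : Fin r → ℂ}
    (hx : x ≠ 0) (h : (e : Hilb d).ofLp = W *ᵥ (c • x)) :
    eigenState he = lineState hW x hx := by
  have hcx : c • x ≠ 0 := by
    intro h0
    rw [h0, Matrix.mulVec_zero] at h
    exact he.2 (Subtype.ext (WithLp.ofLp_injective 2 h))
  rw [eigenState, pureState_eq_liftState (hW := hW) _ _ _ hcx h]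
  exact lineState_eq_of_smul (hx := hcx) rfl

theorem pureOn_orbitState (hP : W * Wᴴ = M.proj i) (hu : IsUnit A) {x : Fin r → ℂ} (hx : x ≠ 0)
    (n : ℕ) : PureOn (M.im i) (orbitState hW hu (Matrix.posSemidef_vecMulVec_self_star x)
      (vecMulVec_star_ne_zero hx) n) := by
  refine pureOn_liftState hP (x := A ^ n *ᵥ x) ?_ _ _ (mul_vecMulVec_mul _ _)
  intro h
  exact hx (Matrix.mulVec_injective_of_isUnit (hu.pow n) (by rw [h, Matrix.mulVec_zero]))

theorem mixedOn_orbitState {W : Matrix (Fin d) (Fin 2) ℂ} {hW : Wᴴ * W = 1}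
    {A : Matrix (Fin 2) (Fin 2) ℂ} (hP : W * Wᴴ = M.proj i) (hu : IsUnit A) (n : ℕ) :
    MixedOn (M.im i) (orbitState hW hu Matrix.PosSemidef.one one_ne_zero n) := by
  refine mixedOn_liftState hP _ _ ?_
  have hdet : A.det ≠ 0 := ((Matrix.isUnit_iff_isUnit_det A).1 hu).ne_zero
  rw [Matrix.mul_one, Matrix.det_mul, Matrix.det_conjTranspose, Matrix.det_pow]
  exact mul_ne_zero (pow_ne_zero n hdet) (star_ne_zero.2 (pow_ne_zero n hdet))

end Line

section Triangular

variable {l₁ l₂ b v₁ v₂ : ℂ}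

theorem vec_one_zero_ne_zero : (![1, 0] : Fin 2 → ℂ) ≠ 0 := fun h => one_ne_zero (congrFun h 0)

theorem vec_zero_one_ne_zero : (![0, 1] : Fin 2 → ℂ) ≠ 0 := fun h => one_ne_zero (congrFun h 1)

theorem vec_ne_zero (hv₂ : v₂ ≠ 0) : ![v₁, v₂] ≠ 0 := fun h => hv₂ (congrFun h 1)

theorem triangular_mulVec_one_zero : !![l₁, b; 0, l₂] *ᵥ ![1, 0] = l₁ • ![1, 0] := by
  ext i
  fin_cases i <;> simp

theorem triangular_zero_mulVec : !![l₁, b; 0, 0] *ᵥ ![v₁, v₂] = (l₁ * v₁ + b * v₂) • ![1, 0] := by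
  ext i
  fin_cases i <;> simp [mul_comm]

theorem eigenvector_eq_smul {y : Fin 2 → ℂ} (hne : l₁ ≠ l₂)
    (h : !![l₁, 0; 0, l₂] *ᵥ y = l₂ • y) : y = y 1 • ![0, 1] := by
  have h0 := congrFun h 0
  simp [Matrix.mulVec, dotProduct, Fin.sum_univ_two, hne] at h0
  ext i
  fin_cases i <;> simp [h0]

theorem divDiff_ne_zero_of_generic (h : ChainType.generic.Cond l₁ l₂) {k : ℕ} (hk : 0 < k) :
    divDiff l₁ l₂ k ≠ 0 := by
  rcases h with ⟨-, hlt, -⟩ | ⟨rfl, hpos, -⟩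
  · have hne : l₁ ≠ l₂ := by
      rintro rfl
      exact lt_irrefl _ hlt
    rw [Ne, divDiff_eq_zero_iff hne]
    intro e
    have e' := congrArg norm e
    rw [norm_pow, norm_pow] at e'
    exact (pow_lt_pow_left₀ hlt (norm_nonneg _) hk.ne').ne' e'
  · rw [divDiff_self]
    exact mul_ne_zero (Nat.cast_ne_zero.2 hk.ne') (pow_ne_zero _ (norm_pos_iff.1 hpos))

theorem exists_tendsto_triangular_pow (h : ChainType.generic.Cond l₁ l₂) (hb : b ≠ 0)
    (hv₂ : v₂ ≠ 0) (hv : (l₁ - l₂) * v₁ + b * v₂ ≠ 0) :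
    ∃ (α β : ℂ) (a : ℕ → ℂ), (α ≠ 0 ∨ β ≠ 0) ∧ α * v₁ + β * v₂ ≠ 0 ∧ (∀ᶠ n in atTop, a n ≠ 0) ∧
      Tendsto (fun n => (a n)⁻¹ • !![l₁, b; 0, l₂] ^ n) atTop (𝓝 !![α, β; 0, 0]) := by
  rcases h with ⟨hpos, hlt, -⟩ | ⟨rfl, hpos, -⟩
  · have h₁ : l₁ ≠ 0 := norm_pos_iff.1 (hpos.trans hlt)
    have hne : l₁ - l₂ ≠ 0 := sub_ne_zero.2 fun e => by
      rw [e] at hlt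
      exact lt_irrefl _ hlt
    refine ⟨1, b / (l₁ - l₂), fun n => l₁ ^ n, Or.inl one_ne_zero, fun h0 => hv ?_,
      Eventually.of_forall fun n => pow_ne_zero n h₁, tendsto_triangular_pow_of_norm_lt hlt⟩
    field_simp at h0
    linear_combination h0
  · have h₁ : l₁ ≠ 0 := norm_pos_iff.1 hpos
    refine ⟨0, b, fun n => n * l₁ ^ (n - 1), Or.inr hb, ?_, ?_, tendsto_triangular_pow_self h₁⟩
    · rw [zero_mul, zero_add]
      exact mul_ne_zero hb hv₂
    · filter_upwards [eventually_gt_atTop 0] with n hn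
      exact mul_ne_zero (Nat.cast_ne_zero.2 hn.ne') (pow_ne_zero _ h₁)

variable {d : ℕ} {W : Matrix (Fin d) (Fin 2) ℂ} {hW : Wᴴ * W = 1}
  {hu : IsUnit !![l₁, b; 0, l₂]}

theorem orbitState_one_injective_of_norm_lt (h : ‖l₂‖ < ‖l₁‖) :
    Function.Injective (orbitState hW hu Matrix.PosSemidef.one one_ne_zero) :=
  orbitState_injective _ _ _ fun _ hk => conj_triangular_pow_one_ne h hk

theorem orbitState_one_injective (hb : b ≠ 0) (h₂ : l₂ ≠ 0)
    (h : ∀ k, 0 < k → divDiff l₁ l₂ k ≠ 0) :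
    Function.Injective (orbitState hW hu Matrix.PosSemidef.one one_ne_zero) :=
  orbitState_injective _ _ _ fun k hk => mt (conj_triangular_pow_one_iff hb h₂).1 (h k hk)

theorem orbitState_vec_injective (hv₂ : v₂ ≠ 0) (hv : (l₁ - l₂) * v₁ + b * v₂ ≠ 0)
    (h : ∀ k, 0 < k → divDiff l₁ l₂ k ≠ 0) :
    Function.Injective (orbitState hW hu (Matrix.posSemidef_vecMulVec_self_star ![v₁, v₂])
      (vecMulVec_star_ne_zero (vec_ne_zero hv₂))) :=
  orbitState_injective _ _ _ fun k hk => mt (conj_triangular_pow_vecMulVec_iff hv₂ hv).1 (h k hk)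

theorem tendsto_orbitState_one {α β : ℂ} {a : ℕ → ℂ} (hαβ : α ≠ 0 ∨ β ≠ 0)
    (ha : ∀ᶠ n in atTop, a n ≠ 0)
    (hlim : Tendsto (fun n => (a n)⁻¹ • !![l₁, b; 0, l₂] ^ n) atTop (𝓝 !![α, β; 0, 0])) :
    Tendsto (orbitState hW hu Matrix.PosSemidef.one one_ne_zero) atTop
      (𝓝 (lineState hW ![1, 0] vec_one_zero_ne_zero)) :=
  tendsto_orbitState _ _ _ _ _ ha hlim (normSq_add_ne_zero hαβ) (conj_first_row_one α β)

theorem tendsto_orbitState_vec {α β : ℂ} {a : ℕ → ℂ} (hv₂ : v₂ ≠ 0)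
    (hαβ : α * v₁ + β * v₂ ≠ 0) (ha : ∀ᶠ n in atTop, a n ≠ 0)
    (hlim : Tendsto (fun n => (a n)⁻¹ • !![l₁, b; 0, l₂] ^ n) atTop (𝓝 !![α, β; 0, 0])) :
    Tendsto (orbitState hW hu (Matrix.posSemidef_vecMulVec_self_star ![v₁, v₂])
      (vecMulVec_star_ne_zero (vec_ne_zero hv₂))) atTop
      (𝓝 (lineState hW ![1, 0] vec_one_zero_ne_zero)) :=
  tendsto_orbitState _ _ _ _ _ ha hlim (mul_ne_zero hαβ (star_ne_zero.2 hαβ))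
    (conj_first_row_vecMulVec α β v₁ v₂)

end Triangular

theorem maps_one_of_born_zero {d : ℕ} {U : Matrix.unitaryGroup (Fin d) ℂ} {M : PVM d 2}
    {z : Hilb d} (hz : ‖z‖ = 1) {hz0 : z ≠ 0}
    (hQ : M.proj 1 = Matrix.vecMulVec z.ofLp (star z.ofLp)) {ρ : State d}
    (h : (pifs U M).p 0 ρ = 0) : (pifs U M).p 1 ρ = 1 ∧
      (pifs U M).Maps 1 ρ (pureState z hz0) ∧ (pifs U M).trans ρ (pureState z hz0) = 1 := by
  have hs := (pifs U M).sum_p ρ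
  rw [Fin.sum_univ_two, h, zero_add] at hs
  exact ⟨hs, maps_pureState_of_pos hz0 hQ (by rw [hs]; exact one_pos),
    by rw [trans_pureState hz hQ, hs]⟩

/-- With `b = 0` and distinct eigenvalues, the second eigenline is the second coordinate axis. When
`‖l₁‖ = 1` this is also the line of `v`, since `v₁ = 0`. -/
theorem eigenState_eq_lineState_of_orthogonal {d k : ℕ} {U : Matrix.unitaryGroup (Fin d) ℂ}
    {M : PVM d k} {i : Fin k} {W : Matrix (Fin d) (Fin 2) ℂ} {hW : Wᴴ * W = 1}
    (hP : W * Wᴴ = M.proj i) {l₁ l₂ v₂ : ℂ} (hT : Wᴴ * U.1 * W = !![l₁, 0; 0, l₂])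
    (hne : l₁ ≠ l₂) {e : M.im i} (he : Module.End.HasEigenvector (compression U M i) l₂ e)
    (hv₂ : v₂ ≠ 0) : eigenState he = lineState hW ![0, v₂] (vec_ne_zero hv₂) := by
  have heW : (e : Hilb d).ofLp = W *ᵥ (Wᴴ *ᵥ (e : Hilb d).ofLp) := by
    rw [Matrix.mulVec_mulVec, hP, PVM.proj_mulVec_of_mem e.2]
  have h := mulVec_of_hasEigenvector hW hP he heW
  rw [hT] at h
  rw [eigenvector_eq_smul hne h] at heW
  rw [eigenState_eq_lineState (hW := hW) he vec_zero_one_ne_zero heW]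
  exact lineState_eq_of_smul (c := v₂⁻¹) (by ext i; fin_cases i <;> simp [hv₂])

end QPIFS

end

/-! ### The classification theorem -/

open QPIFS in
theorem theorem4p13
    -- the unitary and a measurement with one projection of rank 2 (outcome 0, the ball)
    -- and one of rank 1 (outcome 1, the point `ρ_z`)
    (U : Matrix.unitaryGroup (Fin 3) ℂ) (M : PVM 3 2)
    (hM₁ : (M.proj 0).rank = 2) (hM₂ : (M.proj 1).rank = 1)
    (z : Hilb 3) (hz : ‖z‖ = 1) (hz0 : z ≠ 0) (hzM : M.im 1 = Submodule.span ℂ {z})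
    -- the eigenvalues of `A = Π₁ U|_Θ`, with multiplicity, and their eigenvectors
    (l₁ l₂ : ℂ) (hA : (compression U M 0).charpoly = (X - C l₁) * (X - C l₂))
    (hle : ‖l₂‖ ≤ ‖l₁‖)
    (e₁ e₂ : M.im 0)
    (he₁ : Module.End.HasEigenvector (compression U M 0) l₁ e₁)
    (he₂ : Module.End.HasEigenvector (compression U M 0) l₂ e₂)
    (ρz ρm : State 3) (hρz : ρz = pureState z hz0) (hρm : ρm = M.maxMixedOn 0)
    (v : Hilb 3)
    (hv : v = Matrix.toEuclideanLin (M.proj 0) (Matrix.toEuclideanLin U.1 z))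
    (ω : ℂ) (hω : ω = inner ℂ z (Matrix.toEuclideanLin U.1 z)) :
    -- the chain started from the maximally mixed state: initial distribution, state space,
    -- transition probabilities
    ((pifs U M).initDist (maxMixed 3) ρm = 2 / 3 ∧
      (pifs U M).initDist (maxMixed 3) ρz = 1 / 3 ∧
      (∀ ρ, ρ ≠ ρm → ρ ≠ ρz → (pifs U M).initDist (maxMixed 3) ρ = 0) ∧
      (pifs U M).stateSpace (maxMixed 3) =
        {ρ | ∃ n, (pifs U M).Evolves (List.replicate n 0) ρz ρ ∨
          (pifs U M).Evolves (List.replicate n 0) ρm ρ} ∧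
      (∀ ρ, (pifs U M).trans ρ ρz = (pifs U M).p 1 ρ) ∧
      (∀ ρ ρ', (pifs U M).Maps 0 ρ ρ' → (pifs U M).trans ρ ρ' = (pifs U M).p 0 ρ) ∧
      (∀ ρ ρ', ρ' ≠ ρz → ¬ (pifs U M).Maps 0 ρ ρ' → (pifs U M).trans ρ ρ' = 0)) ∧
    -- exactly one of the eight types occurs
    (∃! τ : ChainType, τ.Cond l₁ l₂) ∧
    -- unitary
    (ChainType.unitary.Cond l₁ l₂ →
      (pifs U M).p 1 ρz = 1 ∧ (pifs U M).Maps 1 ρz ρz ∧ (pifs U M).p 0 ρz = 0 ∧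
      (pifs U M).p 0 ρm = 1 ∧ (pifs U M).Maps 0 ρm ρm ∧
      (pifs U M).stateSpace (maxMixed 3) = {ρz, ρm} ∧ ρz ≠ ρm ∧
      (pifs U M).trans ρz ρz = 1 ∧ (pifs U M).trans ρz ρm = 0 ∧
      (pifs U M).trans ρm ρm = 1 ∧ (pifs U M).trans ρm ρz = 0) ∧
    -- all the other types: the system can go from `ρ_z` to the state `ρ_v` in the ball
    (¬ ChainType.unitary.Cond l₁ l₂ → ∃ (hv0 : v ≠ 0) (ρv : State 3),
      ρv = pureState v hv0 ∧ PureOn (M.im 0) ρv ∧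
      (pifs U M).Maps 0 ρz ρv ∧ (pifs U M).p 0 ρz = 1 - ‖ω‖ ^ 2 ∧
      -- generic
      (ChainType.generic.Cond l₁ l₂ → ∃ s t : ℕ → State 3,
        (pifs U M).IsTrajectory 0 ρv s ∧ (pifs U M).IsTrajectory 0 ρm t ∧
        Function.Injective s ∧ Function.Injective t ∧
        (∀ n, PureOn (M.im 0) (s n)) ∧ (∀ n, MixedOn (M.im 0) (t n)) ∧
        Tendsto s atTop (𝓝 (eigenState he₁)) ∧ Tendsto t atTop (𝓝 (eigenState he₁))) ∧
      -- taupek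
      (ChainType.taupek.Cond l₁ l₂ →
        ρv = eigenState he₂ ∧ (pifs U M).Maps 0 ρv ρv ∧
        (pifs U M).trans ρv ρv = ‖l₂‖ ^ 2 ∧
        ∃ t : ℕ → State 3, (pifs U M).IsTrajectory 0 ρm t ∧ Function.Injective t ∧
          (∀ n, MixedOn (M.im 0) (t n)) ∧ Tendsto t atTop (𝓝 (eigenState he₁))) ∧
      -- infinite-elliptic
      (ChainType.infElliptic.Cond l₁ l₂ → ∃ s t : ℕ → State 3,
        (pifs U M).IsTrajectory 0 ρv s ∧ (pifs U M).IsTrajectory 0 ρm t ∧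
        Function.Injective s ∧ Function.Injective t ∧
        (∀ n, PureOn (M.im 0) (s n)) ∧ (∀ n, MixedOn (M.im 0) (t n)) ∧
        AlmostPeriodic s ∧ AlmostPeriodic t) ∧
      -- finite-elliptic, and circular when `κ = 2`
      (ChainType.finElliptic.Cond l₁ l₂ → ∃ (κ : ℕ) (s t : ℕ → State 3),
        2 ≤ κ ∧ IsPrimitiveRoot (Complex.exp (angle l₁ l₂ * Complex.I)) κ ∧
        (κ = 2 ↔ IsCircular l₁ l₂) ∧
        (pifs U M).IsTrajectory 0 ρv s ∧ (pifs U M).IsTrajectory 0 ρm t ∧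
        (∀ n, PureOn (M.im 0) (s n)) ∧ (∀ n, MixedOn (M.im 0) (t n)) ∧
        PeriodicWithPeriod s κ ∧ PeriodicWithPeriod t κ) ∧
      -- all null types: no loop over `ρ_z`
      (l₂ = 0 →
        1 - ‖ω‖ ^ 2 = 1 ∧ (pifs U M).p 0 ρz = 1 ∧ (pifs U M).trans ρz ρz = 0) ∧
      -- generic-null
      (ChainType.genericNull.Cond l₁ l₂ →
        (pifs U M).Maps 0 ρm (eigenState he₁) ∧ (pifs U M).Maps 0 ρv (eigenState he₁) ∧
        (pifs U M).Maps 0 (eigenState he₁) (eigenState he₁) ∧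
        (pifs U M).trans (eigenState he₁) (eigenState he₁) = ‖l₁‖ ^ 2) ∧
      -- taupek-null
      (ChainType.taupekNull.Cond l₁ l₂ →
        (pifs U M).Maps 0 ρm (eigenState he₁) ∧
        (pifs U M).Maps 0 (eigenState he₁) (eigenState he₁) ∧
        (pifs U M).trans (eigenState he₁) (eigenState he₁) = 1 ∧
        ρv = eigenState he₂ ∧ (pifs U M).p 0 ρv = 0 ∧ (pifs U M).Maps 1 ρv ρz ∧
        (pifs U M).trans ρv ρz = 1) ∧
      -- double-null
      (ChainType.doubleNull.Cond l₁ l₂ →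
        (pifs U M).Maps 0 ρm (eigenState he₁) ∧ (pifs U M).Maps 0 ρv (eigenState he₁) ∧
        (pifs U M).p 0 (eigenState he₁) = 0 ∧ (pifs U M).Maps 1 (eigenState he₁) ρz ∧
        (pifs U M).trans (eigenState he₁) ρz = 1)) := by
  have hQ := PVM.proj_eq_vecMulVec hz hzM
  obtain ⟨W, hW, hP, c, hc, hce⟩ := exists_isometry hz hzM e₁.2 fun h => he₁.2 (Subtype.ext h)
  obtain ⟨b, hT⟩ := exists_eq_triangular hW hP hA he₁ he₂ hc hce
  have hPQ : W * Wᴴ + Matrix.vecMulVec z.ofLp (star z.ofLp) = 1 := by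
    rw [hP, ← hQ, ← M.sum_proj, Fin.sum_univ_two]
  obtain ⟨v₁, v₂, u₁, u₂, hv12, hE⟩ := unitaryEntries hW hz hPQ hT
  rw [← hω] at hE
  have hvW : v.ofLp = W *ᵥ ![v₁, v₂] := by
    rw [hv, Matrix.toLpLin_apply, Matrix.toLpLin_apply, ← hP, ← hv12]
    simp only [Matrix.mulVec_mulVec, Matrix.mul_assoc]
  have hρm' : ρm = liftState hW 1 Matrix.PosSemidef.one one_ne_zero :=
    hρm.trans (maxMixedOn_eq_liftState hP)
  have he₁' : eigenState he₁ = lineState hW ![1, 0] vec_one_zero_ne_zero :=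
    eigenState_eq_lineState he₁ (c := c) _ (by simpa using hce)
  have hmapz : (pifs U M).Maps 1 (maxMixed 3) ρz :=
    hρz ▸ maps_pureState_of_pos hz0 hQ (maps_maxMixed 1).pos
  have hmapm : (pifs U M).Maps 0 (maxMixed 3) ρm := hρm ▸ maps_maxMixed 0
  have hmz : ρm ≠ ρz := hρz ▸ ne_pureState_of_maps_zero hz hQ hmapm
  have hp0 : (pifs U M).p 0 (maxMixed 3) = 2 / 3 := by
    rw [born_maxMixed hW hP]
    norm_num
  have hp1 : (pifs U M).p 1 (maxMixed 3) = 1 / 3 := by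
    have hs := (pifs U M).sum_p (maxMixed 3)
    rw [Fin.sum_univ_two, hp0] at hs
    linarith
  have hspace := PIFS.stateSpace_eq_of_maps_one (P := pifs U M)
    (fun x y h => (eq_pureState_of_maps_one (hz0 := hz0) hQ h).trans hρz.symm) hmapz hmapm
  have htz : ∀ ρ, (pifs U M).trans ρ ρz = (pifs U M).p 1 ρ := fun ρ => by
    rw [hρz, trans_pureState hz hQ]
  have ht0 : ∀ ρ ρ', (pifs U M).Maps 0 ρ ρ' → (pifs U M).trans ρ ρ' = (pifs U M).p 0 ρ :=
    fun ρ ρ' h => trans_of_maps_zero hz hz0 hQ h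
  have htn : ∀ ρ ρ', ρ' ≠ ρz → ¬ (pifs U M).Maps 0 ρ ρ' → (pifs U M).trans ρ ρ' = 0 :=
    fun ρ ρ' hne h => trans_eq_zero (hz0 := hz0) hQ (hρz ▸ hne) h
  have hun : unnorm U M 0 ρz = Matrix.vecMulVec v.ofLp (star v.ofLp) := by
    rw [hρz, unnorm_pureState 0 hz, hv, Matrix.toLpLin_apply, Matrix.toLpLin_apply]
  have hpz : (pifs U M).p 0 ρz = 1 - ‖ω‖ ^ 2 := by
    change born U M 0 ρz = _
    rw [born, ← unnorm_trace, hun, hvW, ← mul_vecMulVec_mul, trace_lift hW, ← hE.norm_sq_v,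
      Matrix.trace_vecMulVec]
    simp [dotProduct, Fin.sum_univ_two, Complex.mul_conj', ← Complex.ofReal_pow]
  refine ⟨⟨(ht0 _ _ hmapm).trans hp0, (htz _).trans hp1,
    fun ρ h h' => htn _ _ h' fun h0 => h (h0.unique hmapm), hspace, htz, ht0, htn⟩,
    existsUnique_chainType hle hE.norm_le_one, ?_, ?_⟩
  · rintro ⟨hl, h₁⟩
    obtain rfl := hE.b_eq_zero h₁
    obtain rfl := hE.v₁_eq_zero h₁
    have hω1 : ‖ω‖ ^ 2 = 1 := by
      have h2 := hE.row_two
      have h3 := hE.col_three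
      rw [hl, h₁] at h2
      rw [norm_zero] at h3
      linarith
    have hz0' : (pifs U M).p 0 ρz = 0 := by rw [hpz, hω1, sub_self]
    obtain ⟨hz1, hzmaps, hztrans⟩ := maps_one_of_born_zero (hz0 := hz0) hz hQ hz0'
    rw [← hρz] at hzmaps hztrans
    have hconj : !![l₁, 0; 0, l₂] * 1 * !![l₁, 0; 0, l₂]ᴴ =
        (1 : ℂ) • (1 : Matrix (Fin 2) (Fin 2) ℂ) := by
      rw [conjTranspose_triangular]
      ext i j
      fin_cases i <;> fin_cases j <;> simp [Complex.mul_conj', h₁, hl]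
    have hm1 : (pifs U M).p 0 ρm = 1 := by
      rw [hρm', born_liftState_of_conj hP hT.symm _ _ hconj, Complex.one_re]
    have hmm : (pifs U M).Maps 0 ρm ρm := by
      rw [hρm']
      exact maps_liftState hP hT.symm _ _ _ _ one_ne_zero hconj
    have hm0 : (pifs U M).p 1 ρm = 0 := by
      have hs := (pifs U M).sum_p ρm
      rw [Fin.sum_univ_two, hm1] at hs
      linarith
    have hnz : ∀ ρ, ¬ (pifs U M).Maps 0 ρz ρ := fun ρ h => by
      have := h.pos
      rw [hz0'] at this
      exact lt_irrefl _ this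
    refine ⟨hz1, hzmaps, hz0', hm1, hmm, ?_, hmz.symm, hztrans, htn _ _ hmz (hnz _),
      (ht0 _ _ hmm).trans hm1, (htz _).trans hm0⟩
    rw [hspace]
    have key : ∀ n ρ, (pifs U M).Evolves (List.replicate n 0) ρm ρ → ρ = ρm := by
      intro n
      induction n with
      | zero => exact fun ρ h => Eq.symm h
      | succ n ih =>
        rintro ρ ⟨x', hx', h⟩
        rw [hx'.unique hmm] at h
        exact ih ρ h
    ext ρ
    constructor
    · rintro ⟨n, h | h⟩
      · cases n with
        | zero => exact Or.inl (Eq.symm h)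
        | succ n =>
          obtain ⟨x', hx', -⟩ := h
          exact absurd hx' (hnz x')
      · exact Or.inr (key n ρ h)
    · rintro (rfl | rfl)
      · exact ⟨0, Or.inl rfl⟩
      · exact ⟨0, Or.inr rfl⟩
  · intro hnu
    -- `‖l₂‖ = 1` would squeeze `‖l₁‖` to `1`, the unitary case.
    have h₂lt : ‖l₂‖ < 1 := by
      refine lt_of_le_of_ne (hle.trans hE.norm_le_one) fun h => hnu ?_
      have h1 : ‖l₁‖ = 1 := le_antisymm hE.norm_le_one (h ▸ hle)
      exact ⟨h.trans h1.symm, h1⟩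
    have hv₂ := hE.v₂_ne_zero h₂lt
    have hx := vec_ne_zero (v₁ := v₁) hv₂
    have hv0 : v ≠ 0 := by
      rintro rfl
      refine hx ((mulVec_eq_iff_of_isometry hW).1 ?_)
      rw [← hvW, Matrix.mulVec_zero]
      rfl
    have hρv : pureState v hv0 = lineState hW ![v₁, v₂] hx := pureState_eq_liftState _ _ _ hx hvW
    have hmapv : (pifs U M).Maps 0 ρz (pureState v hv0) :=
      maps_normState _ _ one_ne_zero (by rw [hun, one_smul])
    refine ⟨hv0, lineState hW ![v₁, v₂] hx, hρv.symm, pureOn_liftState hP hx _ _ rfl,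
      hρv ▸ hmapv, hpz, ?_, ?_, ?_, ?_, ?_, ?_, ?_, ?_⟩
    · intro hg
      have hlt : ‖l₁‖ < 1 := by rcases hg with h | h <;> exact h.2.2
      have h₁ : l₁ ≠ 0 := by
        rcases hg with h | h
        · exact norm_pos_iff.1 (h.1.trans h.2.1)
        · exact norm_pos_iff.1 h.2.1
      have h₂ : l₂ ≠ 0 := by
        rcases hg with h | h
        · exact norm_pos_iff.1 h.1
        · exact h.1 ▸ h₁
      have hb := hE.b_ne_zero hle hlt
      have hne := hE.not_eigenvector hle hlt
      have hu : IsUnit !![l₁, b; 0, l₂] := isUnit_triangular h₁ h₂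
      obtain ⟨α, β, a, hαβ, hαv, ha, hlim⟩ := exists_tendsto_triangular_pow hg hb hv₂ hne
      have hS := fun k (hk : 0 < k) => divDiff_ne_zero_of_generic hg hk
      rw [he₁', hρm']
      exact ⟨_, _, isTrajectory_orbitState hP hT.symm hu _ _,
        isTrajectory_orbitState hP hT.symm hu _ _, orbitState_vec_injective hv₂ hne hS,
        orbitState_one_injective hb h₂ hS, pureOn_orbitState hP hu hx, mixedOn_orbitState hP hu,
        tendsto_orbitState_vec hv₂ hαv ha hlim, tendsto_orbitState_one hαβ ha hlim⟩
    · rintro ⟨hpos, hlt, h₁⟩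
      have hl₁ : l₁ ≠ 0 := norm_pos_iff.1 (hpos.trans hlt)
      have hl₂ : l₂ ≠ 0 := norm_pos_iff.1 hpos
      obtain rfl := hE.b_eq_zero h₁
      obtain rfl := hE.v₁_eq_zero h₁
      have hne : l₁ ≠ l₂ := fun h => hlt.ne' (congrArg norm h)
      have hu : IsUnit !![l₁, 0; 0, l₂] := isUnit_triangular hl₁ hl₂
      have hvA : !![l₁, 0; 0, l₂] *ᵥ ![0, v₂] = l₂ • ![0, v₂] := by
        ext i
        fin_cases i <;> simp [mul_comm]
      have hloop := maps_lineState (hW := hW) hP hT.symm hx hx hl₂ hvA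
      refine ⟨?_, hloop, (ht0 _ _ hloop).trans (born_lineState hP hT.symm hx hvA), ?_⟩
      · exact (eigenState_eq_lineState_of_orthogonal hP hT hne he₂ hv₂).symm
      · rw [he₁', hρm']
        exact ⟨_, isTrajectory_orbitState hP hT.symm hu _ _,
          orbitState_one_injective_of_norm_lt hlt, mixedOn_orbitState hP hu,
          tendsto_orbitState_one (Or.inl one_ne_zero)
            (Eventually.of_forall fun n => pow_ne_zero n hl₁)
            (tendsto_triangular_pow_of_norm_lt hlt)⟩
    · rintro ⟨hpos, hl, hlt, hnc⟩
      have hl₁ : l₁ ≠ 0 := norm_pos_iff.1 (hl ▸ hpos)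
      have hl₂ : l₂ ≠ 0 := norm_pos_iff.1 hpos
      have hb := hE.b_ne_zero hle hlt
      have hnev := hE.not_eigenvector hle hlt
      -- Equal eigenvalues would give angle `0`, which is commensurable with `π`.
      have hne : l₁ ≠ l₂ := fun h => hnc ⟨0, by simp [(angle_eq_zero_iff hl hl₁).2 h]⟩
      have hu : IsUnit !![l₁, b; 0, l₂] := isUnit_triangular hl₁ hl₂
      have hS : ∀ k, 0 < k → divDiff l₁ l₂ k ≠ 0 := fun k hk h =>
        hnc (commensurable_of_pow_eq hl hl₁ hk ((divDiff_eq_zero_iff hne k).1 h))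
      rw [hρm']
      exact ⟨_, _, isTrajectory_orbitState hP hT.symm hu _ _,
        isTrajectory_orbitState hP hT.symm hu _ _, orbitState_vec_injective hv₂ hnev hS,
        orbitState_one_injective hb hl₂ hS, pureOn_orbitState hP hu hx, mixedOn_orbitState hP hu,
        almostPeriodic_orbitState hl hl₁ hne hu _ _, almostPeriodic_orbitState hl hl₁ hne hu _ _⟩
    · intro hfe
      obtain ⟨hpos, hl, hlt, hco, hang⟩ := id hfe
      have hl₁ : l₁ ≠ 0 := norm_pos_iff.1 (hl ▸ hpos)
      have hl₂ : l₂ ≠ 0 := norm_pos_iff.1 hpos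
      have hb := hE.b_ne_zero hle hlt
      have hnev := hE.not_eigenvector hle hlt
      have hne : l₁ ≠ l₂ := mt (angle_eq_zero_iff hl hl₁).2 hang
      have hu : IsUnit !![l₁, b; 0, l₂] := isUnit_triangular hl₁ hl₂
      obtain ⟨κ, hκ, hprim⟩ := exists_isPrimitiveRoot hl hl₁ hco
      have hS : ∀ k, divDiff l₁ l₂ k = 0 ↔ κ ∣ k := fun k => by
        rw [divDiff_eq_zero_iff hne, ← div_pow_eq_one_iff hl₁, hprim.pow_eq_one_iff_dvd]
      have hκ2 : 2 ≤ κ := by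
        by_contra hlt
        obtain rfl : κ = 1 := by omega
        rw [IsPrimitiveRoot.one_right_iff, div_eq_one_iff_eq hl₁] at hprim
        exact hne hprim.symm
      have hcirc : κ = 2 ↔ IsCircular l₁ l₂ := by
        constructor
        · rintro rfl
          refine ⟨hfe, ?_⟩
          rw [angle, hprim.eq_neg_one_of_two_right, Complex.arg_neg_one]
        · rintro ⟨-, hpi⟩
          have h := exp_angle hl hl₁
          rw [hpi, Complex.exp_pi_mul_I] at h
          rw [← h] at hprim
          exact hprim.unique (IsPrimitiveRoot.neg_one 0 (by norm_num))
      rw [hρm']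
      exact ⟨κ, _, _, hκ2, (exp_angle hl hl₁).symm ▸ hprim, hcirc,
        isTrajectory_orbitState hP hT.symm hu _ _, isTrajectory_orbitState hP hT.symm hu _ _,
        pureOn_orbitState hP hu hx, mixedOn_orbitState hP hu,
        orbitState_periodic hu _ _ hκ fun k =>
          (conj_triangular_pow_vecMulVec_iff hv₂ hnev).trans (hS k),
        orbitState_periodic hu _ _ hκ fun k =>
          (conj_triangular_pow_one_iff hb hl₂).trans (hS k)⟩
    · intro h₂
      have hpz1 : 1 - ‖ω‖ ^ 2 = 1 := by rw [hE.omega_eq_zero h₂]; simp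
      have hs := (pifs U M).sum_p ρz
      rw [Fin.sum_univ_two, hpz, hpz1] at hs
      refine ⟨hpz1, hpz.trans hpz1, (htz _).trans ?_⟩
      linarith
    · rintro ⟨rfl, hpos, hlt⟩
      have hl₁ : l₁ ≠ 0 := norm_pos_iff.1 hpos
      have hnev := hE.not_eigenvector hle hlt
      rw [sub_zero] at hnev
      rw [he₁', hρm']
      have hloop := maps_lineState (hW := hW) hP hT.symm vec_one_zero_ne_zero vec_one_zero_ne_zero hl₁
        triangular_mulVec_one_zero
      -- With `l₂ = 0` the second row of `A` vanishes, so one step sends everything it does not kill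
      -- to the line of `e₁`.
      exact ⟨maps_liftState hP hT.symm _ _ _ _ (normSq_add_ne_zero (Or.inl hl₁))
          (conj_first_row_one l₁ b),
        maps_lineState hP hT.symm hx _ hnev triangular_zero_mulVec, hloop,
        (ht0 _ _ hloop).trans (born_lineState hP hT.symm _ triangular_mulVec_one_zero)⟩
    · rintro ⟨rfl, h₁⟩
      have hl₁ : l₁ ≠ 0 := norm_ne_zero_iff.1 (by rw [h₁]; exact one_ne_zero)
      obtain rfl := hE.b_eq_zero h₁
      obtain rfl := hE.v₁_eq_zero h₁
      have hvA : !![l₁, 0; 0, 0] *ᵥ ![0, v₂] = (0 : ℂ) • ![0, v₂] := by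
        ext i
        fin_cases i <;> simp
      have hpv : (pifs U M).p 0 (lineState hW ![0, v₂] hx) = 0 := by
        rw [born_lineState hP hT.symm hx hvA]
        simp
      obtain ⟨-, hmapv, htrans⟩ := maps_one_of_born_zero (hz0 := hz0) hz hQ hpv
      rw [← hρz] at hmapv htrans
      rw [he₁', hρm']
      have hloop := maps_lineState (hW := hW) hP hT.symm vec_one_zero_ne_zero vec_one_zero_ne_zero hl₁
        triangular_mulVec_one_zero
      refine ⟨maps_liftState hP hT.symm _ _ _ _ (normSq_add_ne_zero (Or.inl hl₁))
          (conj_first_row_one l₁ 0), hloop, ?_, ?_, hpv, hmapv, htrans⟩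
      · rw [ht0 _ _ hloop, born_lineState hP hT.symm _ triangular_mulVec_one_zero, h₁, one_pow]
      · exact (eigenState_eq_lineState_of_orthogonal hP hT hl₁ he₂ hv₂).symm
    · rintro ⟨rfl, rfl⟩
      have hlt : ‖(0 : ℂ)‖ < 1 := by simp
      have hb := hE.b_ne_zero hle hlt
      have hnev := hE.not_eigenvector hle hlt
      rw [sub_zero] at hnev
      have hpe : (pifs U M).p 0 (lineState hW ![1, 0] vec_one_zero_ne_zero) = 0 := by
        rw [born_lineState hP hT.symm _ triangular_mulVec_one_zero]
        simp
      obtain ⟨-, hmape, htrans⟩ := maps_one_of_born_zero (hz0 := hz0) hz hQ hpe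
      rw [← hρz] at hmape htrans
      rw [he₁', hρm']
      exact ⟨maps_liftState hP hT.symm _ _ _ _ (normSq_add_ne_zero (Or.inr hb))
          (conj_first_row_one 0 b),
        maps_lineState hP hT.symm hx _ hnev triangular_zero_mulVec, hpe, hmape, htrans⟩
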